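/- Let $n\ge 1$ and let $(M,\omega)$ be an $n$-plectic manifold: $M$ is a (finite-dimensional, smooth, real) manifold and $\omega\in\Omega^{n+1}(M)$ is closed and such that $T_pM\to\Lambda^nT_p^*M$, $V\mapsto V\lrcorner\,\omega$, is injective for every $p\in M$. For decomposable multivector fields put $(X_1\wedge\cdots\wedge X_k)\lrcorner\,\tau=X_k\lrcorner\cdots\lrcorner X_1\lrcorner\,\tau$, and extend linearly. For $1\le k\le n$ let $$\Omega^{n-k}_{\mathrm{Ham}}(M)=\{\alpha\in\Omega^{n-k}(M)\;:\;\exists\,X\in\Gamma(\Lambda^kTM),\ d\alpha=-X\lrcorner\,\omega\}.$$ For $\alpha\in\Omega^{n-1}_{\mathrm{Ham}}(M)$ let $X_\alpha$ denote the unique vector field with $d\alpha=-X_\alpha\lrcorner\,\omega$. An $L_\infty$-algebra is a graded vector space $L=\bigoplus_{i\in\mathbb Z}L_i$ with graded skew-symmetric multilinear maps $l_k:L^{\otimes k}\to L$, $k\ge1$, of degree $k-2$, such that for all $m\ge1$ and all homogeneous $x_1,\dots,x_m$ $$\sum_{i+j=m+1}\ \sum_{\sigma\in \mathrm{Sh}(i,m-i)}(-1)^\sigma\epsilon(\sigma)(-1)^{i(j-1)}\,l_j\bigl(l_i(x_{\sigma(1)},\dots,x_{\sigma(i)}),x_{\sigma(i+1)},\dots,x_{\sigma(m)}\bigr)=0,$$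 where $i,j\ge 1$, $\mathrm{Sh}(i,m-i)$ is the set of $(i,m-i)$-unshuffles, $(-1)^\sigma$ is the sign of $\sigma$ and $\epsilon(\sigma)$ is its Koszul sign. It is a Lie $n$-algebra if $L_i=0$ for $i\ge n$. An $L_\infty$-subalgebra is a graded subspace closed under all $l_k$. The Lie $n$-algebra of observables $(L,\{l_k\})$ of $(M,\omega)$ is given by $L_0=\Omega^{n-1}_{\mathrm{Ham}}(M)$, $L_i=\Omega^{n-1-i}(M)$ for $1\le i\le n-1$, and $L_i=0$ otherwise. The map $l_1$ is $d$ in degrees $>0$ and is $0$ in degree $0$. For $k\ge2$, $$l_k(\alpha_1,\dots,\alpha_k)=-(-1)^{k(k+1)/2}\,X_{\alpha_k}\lrcorner\cdots\lrcorner X_{\alpha_1}\lrcorner\,\omega$$ if all the $\alpha_a$ have degree $0$, and $l_k$ vanishes on homogeneous arguments of positive total degree. Theorem. $(L,\{l_k\})$ is a Lie $n$-algebra, and the Hamiltonian forms $\widehat L=\bigoplus_{i=0}^{n-1}\widehat L_i$, $\widehat L_i=\Omega^{n-1-i}_{\mathrm{Ham}}(M)$, form an $L_\infty$-subalgebra of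 $(L,\{l_k\})$. Moreover, let $H\in\Omega^{n-1}_{\mathrm{Ham}}(M)$ with Hamiltonian vector field $X_H$, and call $\alpha\in\Omega^{n-k}_{\mathrm{Ham}}(M)$ locally, globally or strictly conserved if $\mathcal L_{X_H}\alpha$ is closed, exact or zero, respectively. Then the spaces $\mathcal C_{\mathrm{loc}}(X_H)\cap\widehat L$, $\mathcal C(X_H)\cap\widehat L$ and $\mathcal C_{\mathrm{str}}(X_H)\cap\widehat L$ of locally, globally and strictly conserved Hamiltonian forms are $L_\infty$-subalgebras of $(\widehat L,\{l_k\})$. -/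

import Mathlib

open scoped Manifold ContDiff Topology

noncomputable section

namespace Multisymplectic

/-! ## L∞-algebras -/

section LInfty

/-- The Koszul sign `ε(σ)` of a permutation of homogeneous elements of degrees `d`: every inversion
of `σ` contributes the sign `(-1)^{d d'}`, where `d` and `d'` are the two degrees involved. -/
def koszulSign {k : ℕ} (d : Fin k → ℤ) (σ : Equiv.Perm (Fin k)) : ℤˣ :=
  ∏ q : Fin k × Fin k with q.1 < q.2 ∧ σ q.2 < σ q.1, (d (σ q.1) * d (σ q.2)).negOnePow

/-- `σ` is an `(i, m - i)`-unshuffle: it is increasing on the first `i` letters and increasing on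
the last `m - i` letters. -/
def IsUnshuffle {m : ℕ} (i : ℕ) (σ : Equiv.Perm (Fin m)) : Prop :=
  ∀ a b : Fin m, a < b → ((b : ℕ) < i ∨ i ≤ (a : ℕ)) → σ a < σ b

variable {V : Type*} [AddCommGroup V] [Module ℝ V]

open Classical in
/-- The left-hand side of the `m`-th generalized Jacobi identity at homogeneous elements
`x₁, …, x_m` of degrees `d₁, …, d_m`, i.e. the sum over `i + j = m + 1` and over all
`(i, m - i)`-unshuffles `σ` of
`(-1)^σ ε(σ) (-1)^{i (j - 1)} l_j (l_i (x_{σ(1)}, …, x_{σ(i)}), x_{σ(i+1)}, …, x_{σ(m)})`.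
The summation index `i : Fin m` stands for the arity `i + 1`, so that `j - 1 = m - 1 - i`. -/
def jacobiator (l : (k : ℕ) → (Fin k → V) → V) {m : ℕ} (d : Fin m → ℤ) (x : Fin m → V) : V :=
  ∑ i : Fin m, ∑ σ : Equiv.Perm (Fin m) with IsUnshuffle (i + 1) σ,
    (Equiv.Perm.sign σ * koszulSign d σ * (-1) ^ (((i : ℕ) + 1) * (m - 1 - i)) : ℤˣ) •
      l (m - 1 - i + 1)
        (Fin.cons (l (i + 1) fun a : Fin (i + 1) => x (σ ⟨a, by omega⟩))
          fun b : Fin (m - 1 - i) => x (σ ⟨i + 1 + b, by omega⟩))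

/-- `W = ⊕ᵢ Wᵢ` is closed under the operations `l_k`, `k ≥ 1`, with `l_k` of degree `k - 2`. -/
def IsClosedUnder (W : ℤ → Submodule ℝ V) (l : (k : ℕ) → (Fin k → V) → V) : Prop :=
  ∀ k : ℕ, 1 ≤ k → ∀ (d : Fin k → ℤ) (x : Fin k → V), (∀ a, x a ∈ W (d a)) →
    l k x ∈ W ((∑ a, d a) + k - 2)

/-- The graded vector space `L = ⊕ᵢ Lᵢ`, realized as an internal direct sum inside a vector space
`V`, is an L∞-algebra with the operations `l_k`, `k ≥ 1`. Only the values of `l_k` on `L` matter. -/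
structure IsLInftyAlgebra (L : ℤ → Submodule ℝ V) (l : (k : ℕ) → (Fin k → V) → V) : Prop where
  independent : iSupIndep L
  /-- each `l_k` is a map `L^k → L` of degree `k - 2` -/
  degree : IsClosedUnder L l
  /-- each `l_k` is multilinear on `L` -/
  multilinear : ∀ k : ℕ, 1 ≤ k → ∀ x : Fin k → V, (∀ a, x a ∈ ⨆ i, L i) →
    ∀ a : Fin k, ∀ y ∈ ⨆ i, L i, ∀ z ∈ ⨆ i, L i, ∀ c : ℝ,
      l k (Function.update x a (c • y + z)) =
        c • l k (Function.update x a y) + l k (Function.update x a z)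
  /-- each `l_k` is graded skew-symmetric -/
  skew : ∀ k : ℕ, 1 ≤ k → ∀ (d : Fin k → ℤ) (x : Fin k → V), (∀ a, x a ∈ L (d a)) →
    ∀ σ : Equiv.Perm (Fin k),
      l k (fun a => x (σ a)) = (Equiv.Perm.sign σ * koszulSign d σ : ℤˣ) • l k x
  jacobi : ∀ m : ℕ, 1 ≤ m → ∀ (d : Fin m → ℤ) (x : Fin m → V), (∀ a, x a ∈ L (d a)) →
    jacobiator l d x = 0

/-- A Lie `n`-algebra: an L∞-algebra with `Lᵢ = 0` for `i ≥ n`. -/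
structure IsLieNAlgebra (n : ℕ) (L : ℤ → Submodule ℝ V) (l : (k : ℕ) → (Fin k → V) → V) : Prop
    extends IsLInftyAlgebra L l where
  eq_bot : ∀ i : ℤ, (n : ℤ) ≤ i → L i = ⊥

/-- `W` is an L∞-subalgebra of the L∞-algebra `(L, l)`: a graded subspace of `L` that is closed
under all the operations. -/
structure IsLInftySubalgebra (W L : ℤ → Submodule ℝ V) (l : (k : ℕ) → (Fin k → V) → V) : Prop where
  ambient : IsLInftyAlgebra L l
  le : ∀ i, W i ≤ L i
  closed : IsClosedUnder W l

end LInfty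

/-! ## Differential forms and multivector fields on a manifold

`M` is a manifold without boundary modelled on `E`. In Mathlib the tangent space `T_xM` is a copy of
the model space `E`, so a form at `x` is an alternating form on `E`. -/

section Forms

variable (E : Type*) [NormedAddCommGroup E] [NormedSpace ℝ E]
  (M : Type*) [TopologicalSpace M] [ChartedSpace E M]

/-- Not necessarily smooth (inhomogeneous) differential forms; `η x p` is the component of
degree `p` at the point `x`. -/
abbrev RoughForm : Type _ := M → (p : ℕ) → E [⋀^Fin p]→L[ℝ] ℝ

variable {E M}

/-- The degree `p` component of a form, written in the chart at `x₀`, i.e. its pullback by the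
inverse of that chart. -/
def chartRep (x₀ : M) (p : ℕ) (η : RoughForm E M) (y : E) : E [⋀^Fin p]→L[ℝ] ℝ :=
  (η ((extChartAt 𝓘(ℝ, E) x₀).symm y) p).compContinuousLinearMap
    (mfderiv 𝓘(ℝ, E) 𝓘(ℝ, E) (extChartAt 𝓘(ℝ, E) x₀).symm y)

/-- A form is smooth if it is smooth in the charts. -/
def IsSmoothForm (η : RoughForm E M) : Prop :=
  ∀ (x₀ : M) (p : ℕ), ContDiffOn ℝ ∞ (chartRep x₀ p η) (extChartAt 𝓘(ℝ, E) x₀).target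

variable (E M) in
/-- The smooth differential forms on `M`, as a subspace. -/
def smoothForms : Submodule ℝ (RoughForm E M) where
  carrier := {η | IsSmoothForm η}
  zero_mem' := fun _ _ => contDiffOn_const (c := 0)
  add_mem' := fun ha hb x₀ p => (ha x₀ p).add (hb x₀ p)
  smul_mem' := fun c _ ha x₀ p => (ha x₀ p).const_smul c

variable (E M) in
/-- The space `Ω^•(M)` of smooth differential forms on `M`. -/
def DiffForm : Type _ := smoothForms E M

instance : AddCommGroup (DiffForm E M) := inferInstanceAs (AddCommGroup (smoothForms E M))

instance : Module ℝ (DiffForm E M) := inferInstanceAs (Module ℝ (smoothForms E M))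

theorem DiffForm.add_val (η θ : DiffForm E M) : (η + θ).1 = η.1 + θ.1 := rfl

theorem DiffForm.smul_val (c : ℝ) (η : DiffForm E M) : (c • η).1 = c • η.1 := rfl

variable (E M) in
/-- The space `Ω^j(M)` of smooth `j`-forms. It is zero for `j < 0`. -/
def formsOfDegree (j : ℤ) : Submodule ℝ (DiffForm E M) where
  carrier := {η | ∀ (x : M) (p : ℕ), (p : ℤ) ≠ j → η.1 x p = 0}
  zero_mem' := fun _ _ _ => rfl
  add_mem' := fun {η θ} hη hθ x p hp => by
    change η.1 x p + θ.1 x p = 0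
    rw [hη x p hp, hθ x p hp, add_zero]
  smul_mem' := fun c η hη x p hp => by
    change c • η.1 x p = 0
    rw [hη x p hp, smul_zero]

open Classical in
/-- The projection of `Ω^•(M)` onto the components whose degree lies in `S`. -/
def degreeProj (S : Set ℕ) : DiffForm E M →ₗ[ℝ] DiffForm E M where
  toFun η := ⟨fun x p => if p ∈ S then η.1 x p else 0, fun x₀ p => by
    by_cases hp : p ∈ S
    · exact (η.2 x₀ p).congr fun y _ => by simp only [chartRep, if_pos hp]
    · exact (contDiffOn_const (c := (0 : E [⋀^Fin p]→L[ℝ] ℝ))).congr fun y _ => by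
        simp only [chartRep, if_neg hp]; rfl⟩
  map_add' := fun η θ => by
    refine Subtype.ext (funext fun x => funext fun p => ?_)
    change (if p ∈ S then η.1 x p + θ.1 x p else 0) =
      (if p ∈ S then η.1 x p else 0) + (if p ∈ S then θ.1 x p else 0)
    split_ifs <;> simp
  map_smul' := fun c η => by
    refine Subtype.ext (funext fun x => funext fun p => ?_)
    change (if p ∈ S then c • η.1 x p else 0) = c • (if p ∈ S then η.1 x p else 0)
    split_ifs <;> simp

/-- The exterior derivative, computed at `x` in the chart at `x`. -/
def roughExtDeriv (η : RoughForm E M) : RoughForm E M := fun x p =>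
  match p with
  | 0 => 0
  | p + 1 =>
    (extDeriv (chartRep x p η) (extChartAt 𝓘(ℝ, E) x x)).compContinuousLinearMap
      (mfderiv 𝓘(ℝ, E) 𝓘(ℝ, E) (extChartAt 𝓘(ℝ, E) x) x)

/-- The exterior derivative can be computed in any chart. -/
theorem chartRep_roughExtDeriv [IsManifold 𝓘(ℝ, E) ∞ M] {η : RoughForm E M} (hη : IsSmoothForm η)
    (x₀ : M) (p : ℕ) {y : E} (hy : y ∈ (extChartAt 𝓘(ℝ, E) x₀).target) :
    chartRep x₀ (p + 1) (roughExtDeriv η) y = extDeriv (chartRep x₀ p η) y := by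
  set x : M := (extChartAt 𝓘(ℝ, E) x₀).symm y with hx
  have : IsManifold 𝓘(ℝ, E) 1 M := IsManifold.of_le (n := ∞) (by exact_mod_cast le_top)
  have hxs : x ∈ (extChartAt 𝓘(ℝ, E) x₀).source := (extChartAt 𝓘(ℝ, E) x₀).map_target hy
  have hyx : extChartAt 𝓘(ℝ, E) x₀ x = y := (extChartAt 𝓘(ℝ, E) x₀).right_inv hy
  have hot : ∀ z : M, IsOpen (extChartAt 𝓘(ℝ, E) z).target := fun z => isOpen_extChartAt_target z
  -- the transition map
  let g : E → E := fun y' => extChartAt 𝓘(ℝ, E) x ((extChartAt 𝓘(ℝ, E) x₀).symm y')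
  have hsymm : ∀ (z : M) (y' : E), y' ∈ (extChartAt 𝓘(ℝ, E) z).target →
      ContMDiffAt 𝓘(ℝ, E) 𝓘(ℝ, E) ∞ (extChartAt 𝓘(ℝ, E) z).symm y' := fun z y' h =>
    (contMDiffOn_extChartAt_symm (I := 𝓘(ℝ, E)) (n := ∞) z).contMDiffAt ((hot z).mem_nhds h)
  have hchart : ∀ (z z' : M), z' ∈ (extChartAt 𝓘(ℝ, E) z).source →
      ContMDiffAt 𝓘(ℝ, E) 𝓘(ℝ, E) ∞ (extChartAt 𝓘(ℝ, E) z) z' := fun z z' h =>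
    contMDiffAt_extChartAt' (by simpa using h)
  have hnear : ∀ᶠ y' in 𝓝 y, y' ∈ (extChartAt 𝓘(ℝ, E) x₀).target ∧
      (extChartAt 𝓘(ℝ, E) x₀).symm y' ∈ (extChartAt 𝓘(ℝ, E) x).source := by
    refine ((hot x₀).mem_nhds hy |> Filter.Eventually.and <| ?_)
    exact (hsymm x₀ y hy).continuousAt.eventually (extChartAt_source_mem_nhds (I := 𝓘(ℝ, E)) x)
  have hg : ∀ y', y' ∈ (extChartAt 𝓘(ℝ, E) x₀).target →
      (extChartAt 𝓘(ℝ, E) x₀).symm y' ∈ (extChartAt 𝓘(ℝ, E) x).source → ContDiffAt ℝ ∞ g y' := by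
    intro y' h1 h2
    exact contMDiffAt_iff_contDiffAt.1 ((hchart x _ h2).comp y' (hsymm x₀ y' h1))
  have key : chartRep x₀ p η =ᶠ[𝓝 y] fun y' =>
      (chartRep x p η (g y')).compContinuousLinearMap (fderiv ℝ g y') := by
    filter_upwards [hnear.and (eventually_eventually_nhds.2 hnear)] with y' ⟨⟨h1, h2⟩, h3⟩
    have hleft : (extChartAt 𝓘(ℝ, E) x).symm (g y') = (extChartAt 𝓘(ℝ, E) x₀).symm y' :=
      (extChartAt 𝓘(ℝ, E) x).left_inv h2
    have hgt : g y' ∈ (extChartAt 𝓘(ℝ, E) x).target := (extChartAt 𝓘(ℝ, E) x).map_source h2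
    have hcomp : mfderiv 𝓘(ℝ, E) 𝓘(ℝ, E) (extChartAt 𝓘(ℝ, E) x₀).symm y' =
        (mfderiv 𝓘(ℝ, E) 𝓘(ℝ, E) (extChartAt 𝓘(ℝ, E) x).symm (g y')).comp
          (mfderiv 𝓘(ℝ, E) 𝓘(ℝ, E) g y') := by
      rw [← mfderiv_comp y' ((hsymm x _ hgt).mdifferentiableAt (by simp))
        (contMDiffAt_iff_contDiffAt.2 (hg y' h1 h2) |>.mdifferentiableAt (by simp))]
      refine Filter.EventuallyEq.mfderiv_eq ?_
      filter_upwards [h3] with y'' ⟨_, h5⟩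
      exact ((extChartAt 𝓘(ℝ, E) x).left_inv h5).symm
    have hgen : ∀ (m m' : M) (A B : E →L[ℝ] E), m' = m → A = B →
        (η m p).compContinuousLinearMap A = (η m' p).compContinuousLinearMap B := by
      rintro m m' A B rfl rfl; rfl
    rw [← mfderiv_eq_fderiv]
    exact hgen _ _ _ _ hleft hcomp
  have hgx : g y = extChartAt 𝓘(ℝ, E) x x := rfl
  rw [key.extDeriv_eq, extDeriv_pullback (r := ∞) ?_ (hg y hy (mem_extChartAt_source x))
    (by simpa using (WithTop.coe_le_coe.2 le_top : ((2 : ℕ∞) : WithTop ℕ∞) ≤ ∞))]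
  · have hder : (fderiv ℝ g y : E →L[ℝ] E) =
        (mfderiv 𝓘(ℝ, E) 𝓘(ℝ, E) (extChartAt 𝓘(ℝ, E) x) x).comp
          (mfderiv 𝓘(ℝ, E) 𝓘(ℝ, E) (extChartAt 𝓘(ℝ, E) x₀).symm y) := by
      rw [← mfderiv_eq_fderiv]
      exact mfderiv_comp y ((hchart x x (mem_extChartAt_source x)).mdifferentiableAt (by simp))
        ((hsymm x₀ y hy).mdifferentiableAt (by simp))
    rw [hder]
    rfl
  · exact ((hη x p).contDiffAt ((hot x).mem_nhds (mem_extChartAt_target x))).differentiableAt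
      (by simp)


theorem chartRep_add (x₀ : M) (p : ℕ) (η θ : RoughForm E M) :
    chartRep x₀ p (η + θ) = chartRep x₀ p η + chartRep x₀ p θ := rfl

theorem chartRep_smul (x₀ : M) (p : ℕ) (c : ℝ) (η : RoughForm E M) :
    chartRep x₀ p (c • η) = c • chartRep x₀ p η := rfl

theorem contDiff_alternatize (p : ℕ) : ContDiff ℝ ∞
    (fun A : E →L[ℝ] E [⋀^Fin p]→L[ℝ] ℝ => ContinuousAlternatingMap.alternatizeUncurryFin A) :=
  show ContDiff ℝ ∞ ⇑(ContinuousAlternatingMap.alternatizeUncurryFinCLM ℝ E ℝ (n := p)) from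
    ContinuousLinearMap.contDiff _

theorem IsSmoothForm.roughExtDeriv [IsManifold 𝓘(ℝ, E) ∞ M] {η : RoughForm E M}
    (hη : IsSmoothForm η) : IsSmoothForm (roughExtDeriv η) := by
  rintro x₀ (_ | p)
  · exact contDiffOn_const (c := 0)
  · refine ContDiffOn.congr ?_ fun y hy => chartRep_roughExtDeriv hη x₀ p hy
    have h : ContDiffOn ℝ ∞ (fderiv ℝ (chartRep x₀ p η)) (extChartAt 𝓘(ℝ, E) x₀).target :=
      (hη x₀ p).fderiv_of_isOpen (isOpen_extChartAt_target x₀) (by simp)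
    exact (contDiff_alternatize p).comp_contDiffOn h

/-- The exterior derivative `d : Ω^•(M) → Ω^•(M)`. -/
def extD [IsManifold 𝓘(ℝ, E) ∞ M] : DiffForm E M →ₗ[ℝ] DiffForm E M where
  toFun η := ⟨roughExtDeriv η.1, η.2.roughExtDeriv⟩
  map_add' := by
    intro η θ
    have hd : ∀ (ζ : DiffForm E M) (x : M) (p : ℕ), DifferentiableAt ℝ (chartRep x p ζ.1)
        (extChartAt 𝓘(ℝ, E) x x) := fun ζ x p =>
      ((ζ.2 x p).contDiffAt ((isOpen_extChartAt_target x).mem_nhds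
        (mem_extChartAt_target x))).differentiableAt (by simp)
    refine Subtype.ext (funext fun x => funext fun p => ?_)
    cases p with
    | zero => exact (add_zero 0).symm
    | succ p =>
      have h := extDeriv_add (hd η x p) (hd θ x p)
      rw [← chartRep_add] at h
      have h' := congrArg (fun τ : E [⋀^Fin (p + 1)]→L[ℝ] ℝ => τ.compContinuousLinearMap
        (mfderiv 𝓘(ℝ, E) 𝓘(ℝ, E) (extChartAt 𝓘(ℝ, E) x) x : E →L[ℝ] E)) h
      exact h'
  map_smul' := by
    intro c η
    refine Subtype.ext (funext fun x => funext fun p => ?_)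
    cases p with
    | zero => exact (smul_zero c).symm
    | succ p =>
      have h := extDeriv_smul (x := extChartAt 𝓘(ℝ, E) x x) c (chartRep x p η.1)
      rw [← chartRep_smul] at h
      have h' := congrArg (fun τ : E [⋀^Fin (p + 1)]→L[ℝ] ℝ => τ.compContinuousLinearMap
        (mfderiv 𝓘(ℝ, E) 𝓘(ℝ, E) (extChartAt 𝓘(ℝ, E) x) x : E →L[ℝ] E)) h
      exact h'

variable (E M) in
/-- Smooth vector fields `Γ(TM)`. -/
abbrev VField [IsManifold 𝓘(ℝ, E) ∞ M] : Type _ :=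
  Cₛ^∞⟮𝓘(ℝ, E); E, fun x : M => TangentSpace 𝓘(ℝ, E) x⟯

/-- The interior product `v ⌟ τ` at a point: `(v ⌟ τ)(v₁, …, v_p) = τ(v, v₁, …, v_p)`, and
`v ⌟ τ = 0` for `τ` of degree `0`. -/
def contractVec : E →ₗ[ℝ] Module.End ℝ ((p : ℕ) → E [⋀^Fin p]→L[ℝ] ℝ) :=
  LinearMap.mk₂ ℝ (fun v τ p => (τ (p + 1)).curryLeft v)
    (fun v w τ => by ext p : 1; exact map_add _ v w)
    (fun c v τ => by ext p : 1; exact map_smul _ c v)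
    (fun v τ τ' => rfl) (fun c v τ => rfl)

theorem contractVec_contractVec (v : E) (τ : (p : ℕ) → E [⋀^Fin p]→L[ℝ] ℝ) :
    contractVec v (contractVec v τ) = 0 :=
  funext fun p => (τ (p + 2)).curryLeft_same v

/-- The contraction with multivectors at a point, the linear extension of
`(v₁ ∧ ⋯ ∧ v_k) ⌟ τ = v_k ⌟ ⋯ ⌟ v₁ ⌟ τ`. -/
def contractMulti :
    ExteriorAlgebra ℝ E →ₐ[ℝ] (Module.End ℝ ((p : ℕ) → E [⋀^Fin p]→L[ℝ] ℝ))ᵐᵒᵖ :=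
  ExteriorAlgebra.lift ℝ
    ⟨(MulOpposite.opLinearEquiv ℝ).toLinearMap ∘ₗ contractVec, fun v =>
      MulOpposite.unop_injective (LinearMap.ext fun τ => contractVec_contractVec v τ)⟩

open VectorField in
theorem isSmoothForm_contract [IsManifold 𝓘(ℝ, E) ∞ M] [FiniteDimensional ℝ E] (X : VField E M)
    {η : RoughForm E M} (hη : IsSmoothForm η) :
    IsSmoothForm (fun x => contractVec (E := E) (X x) (η x)) := by
  have : CompleteSpace E := FiniteDimensional.complete ℝ E
  have : IsManifold 𝓘(ℝ, E) 1 M := IsManifold.of_le (n := ∞) (by exact_mod_cast le_top)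
  intro x₀ p
  set ψ := (extChartAt 𝓘(ℝ, E) x₀).symm with hψ
  let Xr : E → E := fun y =>
    mpullbackWithin 𝓘(ℝ, E) 𝓘(ℝ, E) ψ (fun x => X x) (Set.range 𝓘(ℝ, E)) y
  have hX : ContDiffOn ℝ ∞ Xr (extChartAt 𝓘(ℝ, E) x₀).target := by
    intro y hy
    have h := ContMDiffWithinAt.mpullbackWithin_vectorField_inter (I := 𝓘(ℝ, E)) (I' := 𝓘(ℝ, E))
      (f := ψ) (s := Set.range 𝓘(ℝ, E)) (t := Set.univ) (x₀ := y) (m := ∞) (n := ∞)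
      (V := fun x => X x) (X.contMDiff (ψ y)).contMDiffWithinAt
      (((contMDiffOn_extChartAt_symm (I := 𝓘(ℝ, E)) (n := ∞) x₀).contMDiffAt
        ((isOpen_extChartAt_target x₀).mem_nhds hy)).contMDiffWithinAt)
      (isInvertible_mfderivWithin_extChartAt_symm hy) (by simp) (by simpa using uniqueMDiffOn_univ)
      (by simp)
    have h2 := (contMDiffWithinAt_vectorSpace_iff_contDiffWithinAt (V := Xr)).1 h
    exact h2.mono (by simp)
  have hrep : ∀ y ∈ (extChartAt 𝓘(ℝ, E) x₀).target,
      chartRep x₀ p (fun x => contractVec (E := E) (X x) (η x)) y =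
        (chartRep x₀ (p + 1) η y).curryLeft (Xr y) := by
    intro y hy
    have hinv := isInvertible_mfderivWithin_extChartAt_symm (I := 𝓘(ℝ, E)) hy
    have h0 : mfderiv 𝓘(ℝ, E) 𝓘(ℝ, E) ψ y (Xr y) = X (ψ y) := by
      have := hinv.self_apply_inverse (X (ψ y))
      simp only [modelWithCornersSelf_coe, Set.range_id, mfderivWithin_univ] at this
      simp only [Xr, mpullbackWithin, modelWithCornersSelf_coe, Set.range_id, mfderivWithin_univ]
      exact this
    unfold chartRep
    erw [ContinuousAlternatingMap.curryLeft_compContinuousLinearMap]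
    erw [h0]
    rfl
  refine ContDiffOn.congr ?_ hrep
  have h1 : ContDiffOn ℝ ∞ (fun y => (chartRep x₀ (p + 1) η y).curryLeft)
      (extChartAt 𝓘(ℝ, E) x₀).target :=
    (show ContDiff ℝ ∞ ⇑(ContinuousAlternatingMap.curryLeftLI (𝕜 := ℝ) (E := E) (F := ℝ) (n := p))
      from LinearIsometry.contDiff _).comp_contDiffOn (hη x₀ (p + 1))
  exact h1.clm_apply hX

/-- The interior product `X ⌟ τ` of a form with a vector field. -/
def contract [IsManifold 𝓘(ℝ, E) ∞ M] [FiniteDimensional ℝ E] (X : VField E M) :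
    DiffForm E M →ₗ[ℝ] DiffForm E M where
  toFun η := ⟨fun x => contractVec (E := E) (X x) (η.1 x), isSmoothForm_contract X η.2⟩
  map_add' := fun η θ => Subtype.ext <| funext fun x =>
    map_add (contractVec (E := E) (X x)) (η.1 x) (θ.1 x)
  map_smul' := fun c η => Subtype.ext <| funext fun x =>
    map_smul (contractVec (E := E) (X x)) c (η.1 x)

/-- The Lie derivative `𝓛_X τ = d(X ⌟ τ) + X ⌟ dτ`. -/
def lieDeriv [IsManifold 𝓘(ℝ, E) ∞ M] [FiniteDimensional ℝ E] (X : VField E M) :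
    DiffForm E M →ₗ[ℝ] DiffForm E M :=
  extD ∘ₗ contract X + contract X ∘ₗ extD

variable (E M) in
/-- Smooth `k`-vector fields `Γ(Λ^k(TM))`: near every point, a finite sum of terms
`f X₁ ∧ ⋯ ∧ X_k` with a smooth function `f` and smooth vector fields `X₁, …, X_k`. -/
def MultiVField [IsManifold 𝓘(ℝ, E) ∞ M] (k : ℕ) :
    Submodule ℝ (M → ExteriorAlgebra ℝ E) where
  carrier := {P | ∀ x₀ : M, ∃ U : Set M, IsOpen U ∧ x₀ ∈ U ∧
    ∃ (N : ℕ) (f : Fin N → M → ℝ) (X : Fin N → Fin k → (x : M) → TangentSpace 𝓘(ℝ, E) x),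
      (∀ a, ContMDiffOn 𝓘(ℝ, E) 𝓘(ℝ, ℝ) ∞ (f a) U) ∧
      (∀ a i, ContMDiffOn 𝓘(ℝ, E) 𝓘(ℝ, E).tangent ∞
        (fun x => (⟨x, X a i x⟩ : TangentBundle 𝓘(ℝ, E) M)) U) ∧
      ∀ x ∈ U, P x = ∑ a, f a x • ExteriorAlgebra.ιMulti ℝ k (M := E) (fun i => X a i x)}
  zero_mem' := fun x₀ => ⟨Set.univ, isOpen_univ, trivial, 0, Fin.elim0, Fin.elim0,
    fun a => a.elim0, fun a => a.elim0, fun x _ => by simp⟩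
  add_mem' := by
    rintro P Q hP hQ x₀
    obtain ⟨U, hU, hxU, N, f, X, hf, hX, hPX⟩ := hP x₀
    obtain ⟨U', hU', hxU', N', f', X', hf', hX', hQX⟩ := hQ x₀
    refine ⟨U ∩ U', hU.inter hU', ⟨hxU, hxU'⟩, N + N', Fin.append f f', Fin.append X X', ?_, ?_, ?_⟩
    · intro a
      refine Fin.addCases (fun b => ?_) (fun b => ?_) a
      · rw [Fin.append_left]; exact (hf b).mono Set.inter_subset_left
      · rw [Fin.append_right]; exact (hf' b).mono Set.inter_subset_right
    · intro a
      refine Fin.addCases (fun b => ?_) (fun b => ?_) a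
      · rw [Fin.append_left]; exact fun i => (hX b i).mono Set.inter_subset_left
      · rw [Fin.append_right]; exact fun i => (hX' b i).mono Set.inter_subset_right
    · intro x hx
      rw [Fin.sum_univ_add]
      simp only [Fin.append_left, Fin.append_right]
      rw [← hPX x hx.1, ← hQX x hx.2]
      rfl
  smul_mem' := by
    rintro c P hP x₀
    obtain ⟨U, hU, hxU, N, f, X, hf, hX, hPX⟩ := hP x₀
    refine ⟨U, hU, hxU, N, fun a x => c * f a x, X, ?_, hX, ?_⟩
    · exact fun a => contMDiffOn_const.mul (hf a)
    · intro x hx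
      simp only [mul_smul, ← Finset.smul_sum]
      rw [← hPX x hx]
      rfl

end Forms

/-! ## Multisymplectic geometry -/

section Multisymplectic

variable {E : Type*} [NormedAddCommGroup E] [NormedSpace ℝ E] [FiniteDimensional ℝ E]
  {M : Type*} [TopologicalSpace M] [ChartedSpace E M] [IsManifold 𝓘(ℝ, E) ∞ M]

/-- `w` is an `n`-plectic form: a closed `(n + 1)`-form such that `V ↦ V ⌟ w` is injective on every
tangent space. -/
structure IsNPlectic (n : ℕ) (w : DiffForm E M) : Prop where
  degree : w ∈ formsOfDegree E M (n + 1)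
  closed : extD w = 0
  nondegenerate : ∀ (x : M) (v : TangentSpace 𝓘(ℝ, E) x), contractVec (E := E) v (w.1 x) = 0 → v = 0

/-- `X` is a Hamiltonian vector field of the form `α`: `dα = - X ⌟ w`. -/
def IsHamiltonianVField (w α : DiffForm E M) (X : VField E M) : Prop :=
  extD α = -contract X w

/-- The space `Ω^{n-1}_Ham(M)` of Hamiltonian `(n-1)`-forms. -/
def hamiltonianForms (n : ℕ) (w : DiffForm E M) : Submodule ℝ (DiffForm E M) where
  carrier := {α | α ∈ formsOfDegree E M (n - 1) ∧ ∃ X : VField E M, IsHamiltonianVField w α X}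
  zero_mem' := ⟨zero_mem _, 0, by
    have h : contract (0 : VField E M) w = 0 := Subtype.ext <| funext fun x =>
      LinearMap.congr_fun (map_zero (contractVec (E := E))) (w.1 x)
    rw [IsHamiltonianVField, h, map_zero, neg_zero]⟩
  add_mem' := by
    rintro α β ⟨hα, X, hX⟩ ⟨hβ, Y, hY⟩
    have h : contract (X + Y) w = contract X w + contract Y w := Subtype.ext <| funext fun x =>
      LinearMap.congr_fun (map_add (contractVec (E := E)) (X x) (Y x)) (w.1 x)
    refine ⟨add_mem hα hβ, X + Y, ?_⟩
    rw [IsHamiltonianVField] at hX hY ⊢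
    rw [map_add, hX, hY, h, neg_add]
  smul_mem' := by
    rintro c α ⟨hα, X, hX⟩
    have h : contract (c • X) w = c • contract X w := Subtype.ext <| funext fun x =>
      LinearMap.congr_fun (map_smul (contractVec (E := E)) c (X x)) (w.1 x)
    refine ⟨Submodule.smul_mem _ c hα, c • X, ?_⟩
    rw [IsHamiltonianVField] at hX ⊢
    rw [map_smul, hX, h, smul_neg]

/-- The space `Ω^{n-k}_Ham(M)` of Hamiltonian `(n-k)`-forms: the `(n-k)`-forms `α` for which there
is a `k`-vector field `P` with `dα = - P ⌟ w`. -/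
def hamiltonianMultiForms (n : ℕ) (w : DiffForm E M) (k : ℕ) : Submodule ℝ (DiffForm E M) where
  carrier := {α | α ∈ formsOfDegree E M (n - k) ∧ ∃ P ∈ MultiVField E M k,
    ∀ x, (extD α).1 x = -(contractMulti (P x)).unop (w.1 x)}
  zero_mem' := ⟨zero_mem _, 0, zero_mem _, fun x => by simp; rfl⟩
  add_mem' := by
    rintro α β ⟨hα, P, hP, hPα⟩ ⟨hβ, Q, hQ, hQβ⟩
    refine ⟨add_mem hα hβ, P + Q, add_mem hP hQ, fun x => ?_⟩
    rw [map_add, DiffForm.add_val, Pi.add_apply, hPα, hQβ, Pi.add_apply, map_add,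
      MulOpposite.unop_add, LinearMap.add_apply, neg_add]
  smul_mem' := by
    rintro c α ⟨hα, P, hP, hPα⟩
    refine ⟨Submodule.smul_mem _ c hα, c • P, Submodule.smul_mem _ c hP, fun x => ?_⟩
    rw [map_smul, DiffForm.smul_val, Pi.smul_apply, hPα, Pi.smul_apply, map_smul,
      MulOpposite.unop_smul, LinearMap.smul_apply, smul_neg]

open Classical in
/-- The Hamiltonian vector field `X_α` of a Hamiltonian `(n-1)`-form `α` (unique if `w` is
`n`-plectic). -/
def hamVField (w α : DiffForm E M) : VField E M :=
  if h : ∃ X : VField E M, IsHamiltonianVField w α X then h.choose else 0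

/-- The sign `ζ(k) = -(-1)^{k(k+1)/2}`. -/
def zeta (k : ℕ) : ℝ := -(-1) ^ (k * (k + 1) / 2)

/-- The graded vector space of Rogers' Lie `n`-algebra of observables: `L₀ = Ω^{n-1}_Ham(M)`,
`Lᵢ = Ω^{n-1-i}(M)` for `1 ≤ i ≤ n - 1`, and `Lᵢ = 0` otherwise. -/
def observables (n : ℕ) (w : DiffForm E M) (i : ℤ) : Submodule ℝ (DiffForm E M) :=
  if i = 0 then hamiltonianForms n w
  else if 1 ≤ i ∧ i ≤ n - 1 then formsOfDegree E M (n - 1 - i) else ⊥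

/-- The operations `l_k` of the Lie `n`-algebra of observables, extended multilinearly from
homogeneous elements. Since the degree of an `(n-1-i)`-form is `i`, the operation `l₁` is `d` on the
components of form degree `< n - 1`, and is zero on `(n-1)`-forms; for `k ≥ 2`,
`l_k (α₁, …, α_k) = ζ(k) X_{α_k} ⌟ ⋯ ⌟ X_{α₁} ⌟ w` depends on the components of form degree `n - 1`
only, so it is zero if some argument is homogeneous of positive degree. -/
def obsBracket (n : ℕ) (w : DiffForm E M) : (k : ℕ) → (Fin k → DiffForm E M) → DiffForm E M
  | 0, _ => 0
  | 1, α => extD (degreeProj {p | p + 1 < n} (α 0))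
  | k + 2, α => zeta (k + 2) •
      (List.ofFn fun a => hamVField w (degreeProj {p | p + 1 = n} (α a))).foldl
        (fun τ X => contract X τ) w

/-- Places spaces `S k` of `(n-k)`-forms, `1 ≤ k ≤ n`, in degree `i = k - 1`. -/
def regrade (n : ℕ) (S : ℕ → Submodule ℝ (DiffForm E M)) (i : ℤ) : Submodule ℝ (DiffForm E M) :=
  if 0 ≤ i ∧ i ≤ n - 1 then S (i.toNat + 1) else ⊥

/-- The graded vector space `L̂ᵢ = Ω^{n-1-i}_Ham(M)`, `i = 0, …, n - 1`, of Hamiltonian forms. -/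
def hamiltonianObservables (n : ℕ) (w : DiffForm E M) : ℤ → Submodule ℝ (DiffForm E M) :=
  regrade n (hamiltonianMultiForms n w)

/-- The locally conserved Hamiltonian `(n-k)`-forms: `𝓛_X α` is closed. -/
def locallyConserved (n : ℕ) (w : DiffForm E M) (X : VField E M) (k : ℕ) :
    Submodule ℝ (DiffForm E M) :=
  hamiltonianMultiForms n w k ⊓ (LinearMap.ker extD).comap (lieDeriv X)

/-- The globally conserved Hamiltonian `(n-k)`-forms: `𝓛_X α` is exact. -/
def globallyConserved (n : ℕ) (w : DiffForm E M) (X : VField E M) (k : ℕ) :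
    Submodule ℝ (DiffForm E M) :=
  hamiltonianMultiForms n w k ⊓ ((formsOfDegree E M (n - k - 1)).map extD).comap (lieDeriv X)

/-- The strictly conserved Hamiltonian `(n-k)`-forms: `𝓛_X α = 0`. -/
def strictlyConserved (n : ℕ) (w : DiffForm E M) (X : VField E M) (k : ℕ) :
    Submodule ℝ (DiffForm E M) :=
  hamiltonianMultiForms n w k ⊓ LinearMap.ker (lieDeriv X)

end Multisymplectic

end Multisymplectic

end

/-!
For `2 ≤ k` the bracket `l_k` is, up to sign, `X_k ⌟ ⋯ ⌟ X_1 ⌟ ω`. Since `dω = 0` and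
`𝓛_{X_i} ω = 0`, Cartan's formulas turn the exterior derivative of this form into the contraction of
`ω` with the Chevalley–Eilenberg boundary of `X_1 ∧ ⋯ ∧ X_k`, that is, into a signed sum over pairs
of the contractions with `[X_i, X_j]` followed by the remaining fields. This single identity has two
consequences. It exhibits `l_k(α_1, …, α_k)` as a Hamiltonian form, which for `k = 2` says that
`X_{l_2(α, β)} = [X_α, X_β]`. It is also the generalized Jacobi identity: an inner operation of
arity `1` or at least `3` has Hamiltonian vector field zero, so only the inner arity `2` and the
full arity `m` survive, and no Koszul sign matters because everything vanishes unless all degrees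
are zero.

If `𝓛_X ω = 0` and `α` is locally conserved, then `[X, X_α] ⌟ ω = -𝓛_X dα = 0`, so `[X, X_α] = 0` by
nondegeneracy. Hence `𝓛_X` annihilates every `l_k` of locally conserved forms with `2 ≤ k`, and
`𝓛_X dα = d 𝓛_X α = 0` settles `k = 1`: on locally conserved forms all operations take strictly
conserved values.
-/

noncomputable section

namespace Multisymplectic

section Unshuffles

theorem koszulSign_one {m : ℕ} (d : Fin m → ℤ) : koszulSign d 1 = 1 := by
  rw [koszulSign, Finset.filter_false_of_mem fun q _ h => lt_asymm h.1 h.2, Finset.prod_empty]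

theorem koszulSign_of_forall_eq_zero {m : ℕ} {d : Fin m → ℤ} (hd : ∀ a, d a = 0)
    (σ : Equiv.Perm (Fin m)) : koszulSign d σ = 1 :=
  Finset.prod_eq_one fun q _ => by rw [hd, zero_mul, Int.negOnePow_zero]

theorem isUnshuffle_self_iff {m : ℕ} (σ : Equiv.Perm (Fin m)) : IsUnshuffle m σ ↔ σ = 1 := by
  refine ⟨fun h => ?_, ?_⟩
  · have hmono : StrictMono σ := fun a b hab => h a b hab (Or.inl b.2)
    have hσ : ⇑σ = id := (hmono.range_inj strictMono_id).1 (by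
      rw [σ.surjective.range_eq, Set.range_id])
    exact Equiv.ext (congrFun hσ)
  · rintro rfl a b hab _
    exact hab

/-- The permutation that lists `i`, then `i.succAbove j`, then all other letters in increasing
order; for `i ≤ j.castSucc` it is the `(2, k)`-unshuffle that selects these two letters. -/
def pairPerm {k : ℕ} (i : Fin (k + 2)) (j : Fin (k + 1)) : Equiv.Perm (Fin (k + 2)) :=
  i.cycleRange.symm * Equiv.Perm.decomposeFin.symm (0, j.cycleRange.symm)

variable {k : ℕ} (i : Fin (k + 2)) (j : Fin (k + 1))

theorem pairPerm_zero : pairPerm i j 0 = i := by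
  rw [pairPerm, Equiv.Perm.mul_apply, Equiv.Perm.decomposeFin_symm_apply_zero,
    Fin.cycleRange_symm_zero]

theorem pairPerm_succ (a : Fin (k + 1)) :
    pairPerm i j a.succ = i.succAbove (j.cycleRange.symm a) := by
  rw [pairPerm, Equiv.Perm.mul_apply, Equiv.Perm.decomposeFin_symm_apply_succ,
    Equiv.swap_self, Equiv.refl_apply, Fin.cycleRange_symm_succ]

theorem pairPerm_one : pairPerm i j 1 = i.succAbove j := by
  rw [← Fin.succ_zero_eq_one', pairPerm_succ, Fin.cycleRange_symm_zero]

theorem pairPerm_succ_succ (b : Fin k) :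
    pairPerm i j b.succ.succ = i.succAbove (j.succAbove b) := by
  rw [pairPerm_succ, Fin.cycleRange_symm_succ]

theorem sign_pairPerm : Equiv.Perm.sign (pairPerm i j) = (-1) ^ ((i : ℕ) + j) := by
  rw [pairPerm, Equiv.Perm.sign_mul, Equiv.Perm.decomposeFin.symm_sign, if_pos rfl, one_mul,
    Equiv.Perm.sign_symm, Equiv.Perm.sign_symm, Fin.sign_cycleRange, Fin.sign_cycleRange, pow_add]

theorem isUnshuffle_two_iff {σ : Equiv.Perm (Fin (k + 2))} :
    IsUnshuffle 2 σ ↔ σ 0 < σ 1 ∧ StrictMono fun b : Fin k => σ b.succ.succ := by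
  refine ⟨fun h => ⟨h 0 1 (by simp) (Or.inl (by simp)), fun a b hab =>
    h _ _ (by simpa using hab) (Or.inr (by simp))⟩, fun ⟨h01, hmono⟩ a b hab hpos => ?_⟩
  induction a using Fin.cases with
  | zero =>
    have hb : b = 1 := Fin.ext (by
      have : (0 : ℕ) < b := hab
      have : (b : ℕ) < 2 := hpos.resolve_right (by simp)
      simp only [Fin.val_one]
      omega)
    rwa [hb]
  | succ a =>
    obtain ⟨b, rfl⟩ := Fin.exists_succ_eq.2 (Fin.ne_zero_of_lt hab)
    have hab' : a < b := Fin.succ_lt_succ_iff.1 hab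
    obtain ⟨b, rfl⟩ := Fin.exists_succ_eq.2 (Fin.ne_zero_of_lt hab')
    have ha : 1 ≤ (a : ℕ) := by
      rcases hpos with h | h <;> simp only [Fin.val_succ] at h <;> omega
    obtain ⟨a, rfl⟩ := Fin.exists_succ_eq.2 (show a ≠ 0 from fun h => by simp [h] at ha)
    exact hmono (Fin.succ_lt_succ_iff.1 hab')

theorem range_perm_succ_succ (σ : Equiv.Perm (Fin (k + 2))) :
    Set.range (fun b : Fin k => σ b.succ.succ) = {σ 0, σ 1}ᶜ := by
  have h : Set.range (fun b : Fin k => b.succ.succ) = {0, 1}ᶜ := by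
    ext y
    refine Fin.cases (by simp) (fun y => ?_) y
    refine Fin.cases (by simp [Fin.ext_iff]) (fun y => by simp [Fin.ext_iff]) y
  rw [← Set.image_pair, ← Set.image_compl_eq σ.bijective, ← h, ← Set.range_comp]
  rfl

theorem isUnshuffle_pairPerm_iff : IsUnshuffle 2 (pairPerm i j) ↔ i ≤ j.castSucc := by
  rw [isUnshuffle_two_iff, pairPerm_zero, pairPerm_one, Fin.lt_succAbove_iff_le_castSucc]
  refine and_iff_left fun a b hab => ?_
  simp only [pairPerm_succ_succ]
  exact Fin.strictMono_succAbove i (Fin.strictMono_succAbove j hab)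

theorem IsUnshuffle.eq_of_apply_zero_of_apply_one {σ τ : Equiv.Perm (Fin (k + 2))}
    (hσ : IsUnshuffle 2 σ) (hτ : IsUnshuffle 2 τ) (h0 : σ 0 = τ 0) (h1 : σ 1 = τ 1) : σ = τ := by
  have h : (fun b : Fin k => σ b.succ.succ) = fun b => τ b.succ.succ :=
    ((isUnshuffle_two_iff.1 hσ).2.range_inj (isUnshuffle_two_iff.1 hτ).2).1 (by
      rw [range_perm_succ_succ, range_perm_succ_succ, h0, h1])
  exact Equiv.ext fun x => Fin.cases h0 (fun x => Fin.cases h1 (congrFun h) x) x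

open Classical in
theorem sum_isUnshuffle_two {A : Type*} [AddCommMonoid A] (g : Equiv.Perm (Fin (k + 2)) → A) :
    ∑ σ : Equiv.Perm (Fin (k + 2)) with IsUnshuffle 2 σ, g σ =
      ∑ i : Fin (k + 2), ∑ j : Fin (k + 1),
        if i ≤ j.castSucc then g (pairPerm i j) else 0 := by
  rw [← Finset.sum_product', ← Finset.sum_filter]
  symm
  refine Finset.sum_bij (fun q _ => pairPerm q.1 q.2) ?_ ?_ ?_ fun _ _ => rfl
  · rintro ⟨i, j⟩ hij
    rw [Finset.mem_filter] at hij ⊢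
    exact ⟨Finset.mem_univ _, (isUnshuffle_pairPerm_iff i j).2 hij.2⟩
  · rintro ⟨i, j⟩ - ⟨i', j'⟩ - heq
    obtain rfl : i = i' := by simpa only [pairPerm_zero] using congrArg (fun σ => σ 0) heq
    have hj : i.succAbove j = i.succAbove j' := by
      simpa only [pairPerm_one] using congrArg (fun σ => σ 1) heq
    rw [Fin.succAbove_right_injective hj]
  · intro σ hσ
    have hσ : IsUnshuffle 2 σ := (Finset.mem_filter.1 hσ).2
    obtain ⟨j, hj⟩ := Fin.exists_succAbove_eq (x := σ 1) (y := σ 0) (by simp)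
    have hle : σ 0 ≤ j.castSucc := by
      rw [← Fin.lt_succAbove_iff_le_castSucc, hj]
      exact (isUnshuffle_two_iff.1 hσ).1
    refine ⟨(σ 0, j), Finset.mem_filter.2 ⟨Finset.mem_univ _, hle⟩, ?_⟩
    have hpair := (isUnshuffle_pairPerm_iff _ _).2 hle
    exact hpair.eq_of_apply_zero_of_apply_one hσ (pairPerm_zero _ _) ((pairPerm_one _ _).trans hj)

end Unshuffles

section Jacobiator

variable {V : Type*} [AddCommGroup V] {l : (k : ℕ) → (Fin k → V) → V}

theorem IsLInftyAlgebra.restrict [Module ℝ V] {W L : ℤ → Submodule ℝ V}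
    (hL : IsLInftyAlgebra L l) (hle : ∀ i, W i ≤ L i) (hW : IsClosedUnder W l) :
    IsLInftyAlgebra W l where
  independent := hL.independent.mono hle
  degree := hW
  multilinear k hk x hx a y hy z hz c :=
    hL.multilinear k hk x (fun b => iSup_mono hle (hx b)) a y (iSup_mono hle hy) z
      (iSup_mono hle hz) c
  skew k hk d x hx := hL.skew k hk d x fun a => hle _ (hx a)
  jacobi m hm d x hx := hL.jacobi m hm d x fun a => hle _ (hx a)

open Classical in
/-- The part of the `m`-th generalized Jacobi identity whose inner operation has arity `i + 1`. -/
def jacobiatorTerm (l : (k : ℕ) → (Fin k → V) → V) {m : ℕ} (d : Fin m → ℤ) (x : Fin m → V)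
    (i : Fin m) : V :=
  ∑ σ : Equiv.Perm (Fin m) with IsUnshuffle (i + 1) σ,
    (Equiv.Perm.sign σ * koszulSign d σ * (-1) ^ (((i : ℕ) + 1) * (m - 1 - i)) : ℤˣ) •
      l (m - 1 - i + 1)
        (Fin.cons (l (i + 1) fun a : Fin (i + 1) => x (σ ⟨a, by omega⟩))
          fun b : Fin (m - 1 - i) => x (σ ⟨i + 1 + b, by omega⟩))

theorem jacobiator_eq_sum_jacobiatorTerm {m : ℕ} (d : Fin m → ℤ) (x : Fin m → V) :
    jacobiator l d x = ∑ i, jacobiatorTerm l d x i :=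
  rfl

omit [AddCommGroup V] in
theorem apply_cons_of_eq_zero {s : ℕ} (hs : s = 0) (y : V) (z : Fin s → V) :
    l (s + 1) (Fin.cons y z) = l 1 fun _ => y := by
  subst hs
  exact congrArg (l 1) (funext fun a => by rw [Fin.fin_one_eq_zero a, Fin.cons_zero])

open Classical in
theorem jacobiatorTerm_last {m : ℕ} (d : Fin (m + 1) → ℤ) (x : Fin (m + 1) → V) :
    jacobiatorTerm l d x (Fin.last m) = l 1 fun _ => l (m + 1) x := by
  have hs : m + 1 - 1 - m = 0 := by simp
  have hfilter : ({σ | IsUnshuffle (m + 1) σ} : Finset (Equiv.Perm (Fin (m + 1)))) = {1} := by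
    ext σ
    rw [Finset.mem_filter_univ, Finset.mem_singleton, isUnshuffle_self_iff]
  have hsign : (-1 : ℤˣ) ^ ((m + 1) * (m + 1 - 1 - m)) = 1 := by rw [hs, mul_zero, pow_zero]
  change ∑ σ with IsUnshuffle (m + 1) σ,
    (Equiv.Perm.sign σ * koszulSign d σ * (-1) ^ ((m + 1) * (m + 1 - 1 - m)) : ℤˣ) • _ = _
  rw [hfilter, Finset.sum_singleton, hsign, koszulSign_one, Equiv.Perm.sign_one, mul_one, mul_one,
    one_smul]
  exact apply_cons_of_eq_zero hs _ _

open Classical in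
theorem jacobiatorTerm_one {k : ℕ} (d : Fin (k + 2) → ℤ) (x : Fin (k + 2) → V) :
    jacobiatorTerm l d x 1 =
      ∑ σ : Equiv.Perm (Fin (k + 2)) with IsUnshuffle 2 σ,
        (Equiv.Perm.sign σ * koszulSign d σ) •
          l (k + 1) (Fin.cons (l 2 ![x (σ 0), x (σ 1)]) fun b : Fin k => x (σ b.succ.succ)) := by
  refine Finset.sum_congr rfl fun σ _ => ?_
  have hsign : (-1 : ℤˣ) ^ ((1 + 1) * (k + 2 - 1 - 1)) = 1 := by
    rw [pow_mul, Int.units_sq, one_pow]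
  change (Equiv.Perm.sign σ * koszulSign d σ * (-1) ^ ((1 + 1) * (k + 2 - 1 - 1)) : ℤˣ) • _ = _
  rw [hsign, mul_one]
  congr 2
  refine congrArg₂ _ (congrArg _ (funext fun a => ?_)) (funext fun b => ?_)
  · fin_cases a <;> rfl
  · exact congrArg (fun c => x (σ c)) (Fin.ext (Nat.add_comm _ _))

theorem jacobiatorTerm_eq_zero {m : ℕ} (d : Fin m → ℤ) (x : Fin m → V) (i : Fin m)
    (h : ∀ y z, l (m - 1 - i + 1) (Fin.cons (l (i + 1) y) z) = 0) :
    jacobiatorTerm l d x i = 0 :=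
  Finset.sum_eq_zero fun σ _ => by rw [h, smul_zero]

theorem jacobiator_one (d : Fin 1 → ℤ) (x : Fin 1 → V) :
    jacobiator l d x = l 1 fun _ => l 1 x := by
  rw [jacobiator_eq_sum_jacobiatorTerm, Fin.sum_univ_one]
  exact jacobiatorTerm_last d x

variable (hl : ∀ r s : ℕ, 1 ≤ r → r ≠ 2 → 1 ≤ s → ∀ (y : Fin r → V) (z : Fin s → V),
  l (s + 1) (Fin.cons (l r y) z) = 0)
include hl

theorem jacobiator_two (d : Fin 2 → ℤ) (x : Fin 2 → V) :
    jacobiator l d x = l 1 fun _ => l 2 x := by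
  rw [jacobiator_eq_sum_jacobiatorTerm, Fin.sum_univ_two,
    jacobiatorTerm_eq_zero d x 0 (hl 1 1 le_rfl (by decide) le_rfl), zero_add]
  exact jacobiatorTerm_last d x

open Classical in
theorem jacobiator_add_three {k : ℕ} (d : Fin (k + 3) → ℤ) (x : Fin (k + 3) → V) :
    jacobiator l d x =
      ∑ σ : Equiv.Perm (Fin (k + 3)) with IsUnshuffle 2 σ,
        (Equiv.Perm.sign σ * koszulSign d σ) •
          l (k + 2) (Fin.cons (l 2 ![x (σ 0), x (σ 1)])
            fun b : Fin (k + 1) => x (σ b.succ.succ)) +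
      l 1 fun _ => l (k + 3) x := by
  rw [jacobiator_eq_sum_jacobiatorTerm, ← jacobiatorTerm_one, ← jacobiatorTerm_last (l := l) d x]
  refine Fintype.sum_eq_add 1 (Fin.last (k + 2)) (by simp [Fin.ext_iff]) fun i hi => ?_
  have h1 : (i : ℕ) ≠ 1 := fun h => hi.1 (Fin.ext h)
  have h2 : (i : ℕ) ≠ k + 2 := fun h => hi.2 (Fin.ext h)
  exact jacobiatorTerm_eq_zero d x i (hl _ _ (by omega) (by omega) (by omega))

end Jacobiator

/-- The operations of Cartan's calculus on the space `W` of differential forms: the exterior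
derivative `d`, the interior product `ι v` with a vector field `v : V`, and the Lie bracket of
vector fields, subject to the identities among them that do not refer to degrees of forms. The last
one is `[𝓛_v, ι_w] = ι_[v, w]` with `𝓛_v = d ι_v + ι_v d`. -/
structure CartanCalculus (R V W : Type*) [CommRing R] [AddCommGroup V] [Module R V]
    [AddCommGroup W] [Module R W] where
  d : Module.End R W
  ι : V →ₗ[R] Module.End R W
  bracket : V → V → V
  d_d (τ : W) : d (d τ) = 0
  ι_ι_self (v : V) (τ : W) : ι v (ι v τ) = 0
  d_ι_ι_add_ι_d_ι (v w : V) (τ : W) :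
    d (ι v (ι w τ)) + ι v (d (ι w τ)) = ι w (d (ι v τ) + ι v (d τ)) + ι (bracket v w) τ

namespace CartanCalculus

variable {R V W : Type*} [CommRing R] [AddCommGroup V] [Module R V] [AddCommGroup W] [Module R W]
  (C : CartanCalculus R V W)

/-- The Lie derivative of forms, defined by Cartan's magic formula. -/
def lieD (v : V) : Module.End R W :=
  C.d * C.ι v + C.ι v * C.d

theorem lieD_apply (v : V) (τ : W) : C.lieD v τ = C.d (C.ι v τ) + C.ι v (C.d τ) :=
  rfl

theorem lieD_ι (v w : V) (τ : W) :
    C.lieD v (C.ι w τ) = C.ι w (C.lieD v τ) + C.ι (C.bracket v w) τ :=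
  C.d_ι_ι_add_ι_d_ι v w τ

theorem d_lieD (v : V) (τ : W) : C.d (C.lieD v τ) = C.lieD v (C.d τ) := by
  rw [lieD_apply, lieD_apply, map_add, C.d_d, C.d_d, map_zero, add_zero, zero_add]

theorem ι_ι_swap (v w : V) (τ : W) : C.ι v (C.ι w τ) = -C.ι w (C.ι v τ) := by
  have h := C.ι_ι_self (v + w) τ
  simp only [map_add, LinearMap.add_apply, ι_ι_self, zero_add, add_zero] at h
  rw [eq_neg_iff_add_eq_zero, add_comm]
  exact h

theorem ι_bracket_swap (v w : V) (τ : W) :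
    C.ι (C.bracket v w) τ = -C.ι (C.bracket w v) τ := by
  have hv := C.d_ι_ι_add_ι_d_ι v w τ
  have hw := C.d_ι_ι_add_ι_d_ι w v τ
  rw [C.ι_ι_swap v w τ, map_neg, map_add, C.ι_ι_swap w v (C.d τ)] at hv
  rw [map_add] at hw
  linear_combination (norm := module) -hv - hw

section Closed

variable {C} {v w : V} {τ : W}

theorem d_ι (hτ : C.d τ = 0) : C.d (C.ι v τ) = C.lieD v τ := by
  rw [lieD_apply, hτ, map_zero, add_zero]

theorem d_ι_ι (hτ : C.d τ = 0) (hv : C.lieD v τ = 0) (hw : C.lieD w τ = 0) :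
    C.d (C.ι v (C.ι w τ)) = C.ι (C.bracket v w) τ := by
  have h := C.lieD_ι v w τ
  rwa [lieD_apply, d_ι hτ, hw, hv, map_zero, map_zero, add_zero, zero_add] at h

variable {α : W}

theorem lieD_eq_zero_of_d_eq_neg_ι (hτ : C.d τ = 0) (hα : C.d α = -C.ι v τ) : C.lieD v τ = 0 := by
  rw [← d_ι hτ, ← neg_eq_zero, ← map_neg, ← hα, C.d_d]

theorem ι_bracket_eq_zero (hv : C.lieD v τ = 0) (hα : C.d α = -C.ι w τ)
    (hvα : C.d (C.lieD v α) = 0) : C.ι (C.bracket v w) τ = 0 := by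
  have h := C.lieD_ι v w τ
  rwa [hv, map_zero, zero_add, ← neg_neg (C.ι w τ), ← hα, map_neg, ← C.d_lieD, hvα, neg_zero,
    eq_comm] at h

end Closed

section IterContract

/-- The iterated interior product `τ ↦ ι v_{k-1} ⋯ ι v_0 τ`, as an alternating map in the vector
fields; the opposite algebra accounts for the reversal of the factors. -/
def iterContract (k : ℕ) : V [⋀^Fin k]→ₗ[R] Module.End R W :=
  ((MulOpposite.opLinearEquiv R).symm.toLinearMap ∘ₗ
    (ExteriorAlgebra.lift R ⟨(MulOpposite.opLinearEquiv R).toLinearMap ∘ₗ C.ι, fun v =>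
      MulOpposite.unop_injective (LinearMap.ext (C.ι_ι_self v))⟩).toLinearMap).compAlternatingMap
    (ExteriorAlgebra.ιMulti R k)

variable {k : ℕ}

theorem iterContract_zero (x : Fin 0 → V) (τ : W) : C.iterContract 0 x τ = τ := by
  simp [iterContract]

theorem iterContract_cons (v : V) (x : Fin k → V) (τ : W) :
    C.iterContract (k + 1) (Fin.cons v x) τ = C.iterContract k x (C.ι v τ) := by
  simp [iterContract, ExteriorAlgebra.ιMulti_succ_apply, Function.comp_def, Matrix.vecTail]

theorem iterContract_one (x : Fin 1 → V) (τ : W) : C.iterContract 1 x τ = C.ι (x 0) τ := by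
  rw [← Fin.cons_self_tail x, iterContract_cons, iterContract_zero, Fin.cons_zero]

theorem iterContract_snoc (x : Fin k → V) (v : V) (τ : W) :
    C.iterContract (k + 1) (Fin.snoc x v) τ = C.ι v (C.iterContract k x τ) := by
  induction k generalizing τ with
  | zero => rw [iterContract_one, iterContract_zero, ← Fin.last_zero, Fin.snoc_last]
  | succ k ih =>
    rw [← Fin.cons_self_tail x, ← Fin.cons_snoc_eq_snoc_cons, iterContract_cons, iterContract_cons,
      ih]

theorem iterContract_insertNth (i : Fin (k + 1)) (v : V) (x : Fin k → V) (τ : W) :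
    C.iterContract (k + 1) (i.insertNth v x) τ =
      ((-1 : ℤˣ) ^ (i : ℕ)) • C.iterContract (k + 1) (Fin.cons v x) τ := by
  have h : i.insertNth v x = Fin.cons v x ∘ i.cycleRange := by
    rw [← Fin.insertNth_comp_cycleRange_symm i v x, Function.comp_assoc]
    simp
  rw [h, AlternatingMap.map_perm, Fin.sign_cycleRange, LinearMap.smul_apply]

theorem lieD_iterContract (v : V) (x : Fin k → V) (τ : W) :
    C.lieD v (C.iterContract k x τ) = C.iterContract k x (C.lieD v τ) +
      ∑ i, C.iterContract k (Function.update x i (C.bracket v (x i))) τ := by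
  induction k generalizing τ with
  | zero => simp only [iterContract_zero, Finset.univ_eq_empty, Finset.sum_empty, add_zero]
  | succ k ih =>
    obtain ⟨y, x, rfl⟩ : ∃ y x', x = Fin.cons y x' := ⟨_, _, (Fin.cons_self_tail x).symm⟩
    rw [iterContract_cons, ih, Fin.sum_univ_succ, lieD_ι, map_add]
    simp only [iterContract_cons, Fin.cons_zero, Fin.cons_succ, Fin.update_cons_zero,
      ← Fin.cons_update, add_assoc]

variable {C} in
theorem lieD_iterContract_eq_zero {v : V} {x : Fin k → V} {τ : W} (hτ : C.lieD v τ = 0)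
    (hx : ∀ i, C.bracket v (x i) = 0) : C.lieD v (C.iterContract k x τ) = 0 := by
  rw [lieD_iterContract, hτ, map_zero, zero_add]
  refine Finset.sum_eq_zero fun i _ => ?_
  rw [hx, (C.iterContract k).map_update_zero, LinearMap.zero_apply]

end IterContract

section BracketSum

variable {k : ℕ}

/-- The term of `bracketSum` that belongs to the unshuffle `pairPerm i j`. -/
def bracketTerm (x : Fin (k + 2) → V) (τ : W) (i : Fin (k + 2)) (j : Fin (k + 1)) : W :=
  ((-1 : ℤˣ) ^ ((i : ℕ) + j)) • C.iterContract (k + 1)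
    (Fin.cons (C.bracket (x i) (x (i.succAbove j))) (j.removeNth (i.removeNth x))) τ

open Classical in
/-- The contraction of `τ` with the boundary of `x_0 ∧ ⋯ ∧ x_{k+1}` in the Chevalley–Eilenberg
complex of the Lie bracket, up to the overall sign. -/
def bracketSum (x : Fin (k + 2) → V) (τ : W) : W :=
  ∑ σ : Equiv.Perm (Fin (k + 2)) with IsUnshuffle 2 σ, Equiv.Perm.sign σ •
    C.iterContract (k + 1)
      (Fin.cons (C.bracket (x (σ 0)) (x (σ 1))) fun b => x (σ b.succ.succ)) τ

theorem bracketSum_eq_sum_bracketTerm (x : Fin (k + 2) → V) (τ : W) :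
    C.bracketSum x τ =
      ∑ i : Fin (k + 2), ∑ j : Fin (k + 1),
        if i ≤ j.castSucc then C.bracketTerm x τ i j else 0 := by
  rw [bracketSum, sum_isUnshuffle_two]
  simp only [sign_pairPerm, pairPerm_zero, pairPerm_one, pairPerm_succ_succ]
  rfl

theorem bracketSum_two (x : Fin 2 → V) (τ : W) :
    C.bracketSum x τ = C.ι (C.bracket (x 0) (x 1)) τ := by
  rw [bracketSum_eq_sum_bracketTerm]
  simp [bracketTerm, iterContract_one]

theorem bracketTerm_snoc_castSucc (x : Fin (k + 2) → V) (v : V) (τ : W) (i : Fin (k + 2))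
    (j : Fin (k + 1)) :
    C.bracketTerm (Fin.snoc x v : Fin (k + 3) → V) τ i.castSucc j.castSucc =
      C.ι v (C.bracketTerm x τ i j) := by
  have hrest : j.castSucc.removeNth (i.castSucc.removeNth (Fin.snoc x v : Fin (k + 3) → V)) =
      Fin.snoc (j.removeNth (i.removeNth x)) v := by
    funext a
    refine Fin.lastCases ?_ (fun a => ?_) a
    · simp [Fin.removeNth]
    · simp only [Fin.removeNth, Fin.castSucc_succAbove_castSucc, Fin.snoc_castSucc]
  rw [bracketTerm, bracketTerm, LinearMap.map_smul_of_tower, ← iterContract_snoc,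
    ← Fin.cons_snoc_eq_snoc_cons, hrest, Fin.castSucc_succAbove_castSucc, Fin.snoc_castSucc,
    Fin.snoc_castSucc]
  rfl

theorem bracketTerm_snoc_last (x : Fin (k + 1) → V) (v : V) (τ : W) (i : Fin (k + 1)) :
    C.bracketTerm (Fin.snoc x v : Fin (k + 2) → V) τ i.castSucc (Fin.last k) =
      ((-1 : ℤˣ) ^ (k + 1)) •
        C.iterContract (k + 1) (Function.update x i (C.bracket v (x i))) τ := by
  have hlast : i.castSucc.succAbove (Fin.last k) = Fin.last (k + 1) := by
    rw [Fin.succAbove_castSucc_of_le _ _ (Fin.le_last i), Fin.succ_last]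
  have hrest : (Fin.last k).removeNth (i.castSucc.removeNth (Fin.snoc x v : Fin (k + 2) → V)) =
      i.removeNth x := by
    funext a
    simp only [Fin.removeNth, Fin.succAbove_last, Fin.castSucc_succAbove_castSucc,
      Fin.snoc_castSucc]
  rw [bracketTerm, hlast, hrest, Fin.snoc_castSucc, Fin.snoc_last, iterContract_cons,
    ι_bracket_swap, map_neg, ← iterContract_cons, ← Fin.insertNth_removeNth,
    iterContract_insertNth, smul_smul, ← pow_add, Fin.val_castSucc, Fin.val_last,
    smul_neg, ← Units.neg_smul, ← mul_neg_one, ← pow_succ]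
  congr 2
  ring

theorem bracketSum_snoc (x : Fin (k + 2) → V) (v : V) (τ : W) :
    C.bracketSum (Fin.snoc x v : Fin (k + 3) → V) τ =
      C.ι v (C.bracketSum x τ) + ((-1 : ℤˣ) ^ (k + 2)) •
        ∑ i, C.iterContract (k + 2) (Function.update x i (C.bracket v (x i))) τ := by
  have hlast (j : Fin (k + 2)) : ¬ Fin.last (k + 2) ≤ j.castSucc :=
    not_le.2 (Fin.castSucc_lt_last j)
  have hle (i : Fin (k + 2)) : i.castSucc ≤ (Fin.last (k + 1)).castSucc :=
    Fin.castSucc_le_castSucc_iff.2 (Fin.le_last i)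
  rw [bracketSum_eq_sum_bracketTerm, bracketSum_eq_sum_bracketTerm,
    Fin.sum_univ_castSucc (n := k + 2), map_sum (C.ι v), Finset.smul_sum]
  simp only [hlast, if_false, Finset.sum_const_zero, add_zero, ← Finset.sum_add_distrib]
  refine Finset.sum_congr rfl fun i _ => ?_
  rw [Fin.sum_univ_castSucc (n := k + 1), if_pos (hle i), bracketTerm_snoc_last, map_sum (C.ι v)]
  simp only [Fin.castSucc_le_castSucc_iff, bracketTerm_snoc_castSucc, apply_ite (C.ι v), map_zero]

theorem d_iterContract (x : Fin (k + 2) → V) {τ : W} (hτ : C.d τ = 0)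
    (hx : ∀ i, C.lieD (x i) τ = 0) :
    C.d (C.iterContract (k + 2) x τ) = ((-1 : ℤˣ) ^ (k + 1)) • C.bracketSum x τ := by
  induction k with
  | zero =>
    have hiter : C.iterContract 2 x τ = C.ι (x 1) (C.ι (x 0) τ) := by
      conv_lhs => rw [← Fin.cons_self_tail x, iterContract_cons, iterContract_one]
      rfl
    rw [hiter, d_ι_ι hτ (hx 1) (hx 0), bracketSum_two, ι_bracket_swap]
    simp
  | succ k ih =>
    obtain ⟨x, v, rfl⟩ : ∃ (x' : Fin (k + 2) → V) (v : V), x = Fin.snoc x' v :=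
      ⟨_, _, (Fin.snoc_init_self x).symm⟩
    have hv : C.lieD v τ = 0 := by simpa only [Fin.snoc_last] using hx (Fin.last _)
    have hx' : ∀ i, C.lieD (x i) τ = 0 := fun i => by
      simpa only [Fin.snoc_castSucc] using hx i.castSucc
    have hmagic : C.d (C.ι v (C.iterContract _ x τ)) =
        C.lieD v (C.iterContract _ x τ) - C.ι v (C.d (C.iterContract _ x τ)) :=
      (add_sub_cancel_right _ _).symm
    rw [iterContract_snoc, hmagic, lieD_iterContract, hv, map_zero, zero_add, ih x hx',
      bracketSum_snoc, LinearMap.map_smul_of_tower, smul_add, smul_smul, ← pow_add,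
      Even.neg_one_pow ⟨k + 2, rfl⟩, one_smul, pow_succ _ (k + 1), mul_neg_one,
      Units.neg_smul]
    exact sub_eq_neg_add _ _

end BracketSum

end CartanCalculus

section FlatCartan

open ContinuousAlternatingMap VectorField

variable {𝕜 E F : Type*} [NontriviallyNormedField 𝕜] [NormedAddCommGroup E] [NormedSpace 𝕜 E]
  [NormedAddCommGroup F] [NormedSpace 𝕜 F] {p : ℕ}

theorem curryLeft_curryLeft_swap (v u : E) (τ : E [⋀^Fin (p + 2)]→L[𝕜] F) :
    (τ.curryLeft v).curryLeft u = -(τ.curryLeft u).curryLeft v := by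
  have h := τ.curryLeft_same (v + u)
  simp only [map_add, _root_.add_apply, curryLeft_add, curryLeft_same, zero_add, add_zero] at h
  rw [eq_neg_iff_add_eq_zero, add_comm]
  exact h

theorem curryLeft_sub (τ τ' : E [⋀^Fin (p + 1)]→L[𝕜] F) :
    (τ - τ').curryLeft = τ.curryLeft - τ'.curryLeft :=
  rfl

/-- The interior product with a fixed vector, as a continuous linear map on alternating forms. -/
def curryLeftAt (v : E) : E [⋀^Fin (p + 1)]→L[𝕜] F →L[𝕜] E [⋀^Fin p]→L[𝕜] F :=
  ContinuousLinearMap.apply 𝕜 (E [⋀^Fin p]→L[𝕜] F) v ∘L curryLeftLI.toContinuousLinearMap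

@[simp]
theorem curryLeftAt_apply (v : E) (τ : E [⋀^Fin (p + 1)]→L[𝕜] F) :
    curryLeftAt v τ = τ.curryLeft v :=
  rfl

theorem curryLeft_alternatizeUncurryFin (A : E →L[𝕜] E [⋀^Fin (p + 1)]→L[𝕜] F) (v : E) :
    (alternatizeUncurryFin A).curryLeft v = A v - alternatizeUncurryFin (curryLeftAt v ∘L A) := by
  ext u
  rw [curryLeft_apply_apply, alternatizeUncurryFin_apply, Fin.sum_univ_succ,
    ContinuousAlternatingMap.sub_apply, alternatizeUncurryFin_apply, sub_eq_add_neg,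
    ← Finset.sum_neg_distrib]
  congr 1
  · simp
  · refine Finset.sum_congr rfl fun i _ => ?_
    have h : Fin.removeNth i.succ (Matrix.vecCons v u) = Matrix.vecCons v (Fin.removeNth i u) := by
      funext j
      refine Fin.cases ?_ (fun j => ?_) j <;> simp [Fin.removeNth]
    rw [h]
    simp [pow_succ]

theorem curryLeft_alternatizeUncurryFin_zero (A : E →L[𝕜] E [⋀^Fin 0]→L[𝕜] F) (v : E) :
    (alternatizeUncurryFin A).curryLeft v = A v := by
  ext u
  rw [curryLeft_apply_apply, alternatizeUncurryFin_apply]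
  simp

theorem hasFDerivAt_clm_apply_comp {G G' : Type*} [NormedAddCommGroup G] [NormedSpace 𝕜 G]
    [NormedAddCommGroup G'] [NormedSpace 𝕜 G'] (C : G →L[𝕜] E →L[𝕜] G') {η : E → G} {V : E → E}
    {y : E} (hη : DifferentiableAt 𝕜 η y) (hV : DifferentiableAt 𝕜 V y) :
    HasFDerivAt (fun z => C (η z) (V z)) (C (η y) ∘L fderiv 𝕜 V y + (C ∘L fderiv 𝕜 η y).flip (V y))
      y :=
  (C.hasFDerivAt.comp y hη.hasFDerivAt).clm_apply hV.hasFDerivAt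

theorem hasFDerivAt_curryLeft {η : E → E [⋀^Fin (p + 1)]→L[𝕜] F} {V : E → E} {y : E}
    (hη : DifferentiableAt 𝕜 η y) (hV : DifferentiableAt 𝕜 V y) :
    HasFDerivAt (fun z => (η z).curryLeft (V z))
      (curryLeftAt (V y) ∘L fderiv 𝕜 η y + (η y).curryLeft ∘L fderiv 𝕜 V y) y :=
  (hasFDerivAt_clm_apply_comp
    (curryLeftLI (𝕜 := 𝕜) (E := E) (F := F) (n := p)).toContinuousLinearMap hη hV).congr_fderiv
    (ContinuousLinearMap.ext fun _ => add_comm _ _)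

theorem extDeriv_curryLeft {η : E → E [⋀^Fin (p + 1)]→L[𝕜] F} {V : E → E} {y : E}
    (hη : DifferentiableAt 𝕜 η y) (hV : DifferentiableAt 𝕜 V y) :
    extDeriv (fun z => (η z).curryLeft (V z)) y =
      alternatizeUncurryFin (curryLeftAt (V y) ∘L fderiv 𝕜 η y) +
        alternatizeUncurryFin ((η y).curryLeft ∘L fderiv 𝕜 V y) := by
  rw [extDeriv, (hasFDerivAt_curryLeft hη hV).fderiv, alternatizeUncurryFin_add]

theorem extDeriv_curryLeft_commutator {η : E → E [⋀^Fin (p + 2)]→L[𝕜] F} {V W : E → E} {y : E}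
    (hη : DifferentiableAt 𝕜 η y) (hV : DifferentiableAt 𝕜 V y) (hW : DifferentiableAt 𝕜 W y) :
    extDeriv (fun z => ((η z).curryLeft (W z)).curryLeft (V z)) y +
        (extDeriv (fun z => (η z).curryLeft (W z)) y).curryLeft (V y) -
        ((extDeriv (fun z => (η z).curryLeft (V z)) y).curryLeft (W y) +
          ((extDeriv η y).curryLeft (V y)).curryLeft (W y)) =
      (η y).curryLeft (lieBracket 𝕜 V W y) := by
  have hWη := hasFDerivAt_curryLeft hη hW
  have curry_swap : ((η y).curryLeft (W y)).curryLeft ∘L fderiv 𝕜 V y =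
      -(curryLeftAt (W y) ∘L (η y).curryLeft ∘L fderiv 𝕜 V y) :=
    ContinuousLinearMap.ext fun v => curryLeft_curryLeft_swap _ _ _
  have alternatize_neg : ∀ A : E →L[𝕜] E [⋀^Fin (p + 1)]→L[𝕜] F,
      alternatizeUncurryFin (-(curryLeftAt (W y) ∘L A)) =
        -alternatizeUncurryFin (curryLeftAt (W y) ∘L A) := fun A =>
    map_neg (alternatizeUncurryFinCLM 𝕜 E F) _
  rw [extDeriv_curryLeft hWη.differentiableAt hV, hWη.fderiv, extDeriv_curryLeft hη hW,
    extDeriv_curryLeft hη hV, extDeriv, ContinuousLinearMap.comp_add, alternatizeUncurryFin_add,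
    curry_swap, alternatize_neg]
  simp only [curryLeft_add, _root_.add_apply, curryLeft_alternatizeUncurryFin,
    curryLeft_sub, _root_.sub_apply, ContinuousLinearMap.comp_apply,
    curryLeftAt_apply, lieBracket, map_sub]
  abel

theorem extDeriv_curryLeft_commutator_one {η : E → E [⋀^Fin 1]→L[𝕜] F} {V W : E → E} {y : E}
    (hη : DifferentiableAt 𝕜 η y) (hV : DifferentiableAt 𝕜 V y) (hW : DifferentiableAt 𝕜 W y) :
    (extDeriv (fun z => (η z).curryLeft (W z)) y).curryLeft (V y) -
        ((extDeriv (fun z => (η z).curryLeft (V z)) y).curryLeft (W y) +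
          ((extDeriv η y).curryLeft (V y)).curryLeft (W y)) =
      (η y).curryLeft (lieBracket 𝕜 V W y) := by
  rw [extDeriv_curryLeft hη hW, extDeriv_curryLeft hη hV, extDeriv]
  simp only [curryLeft_add, _root_.add_apply, curryLeft_alternatizeUncurryFin,
    curryLeft_alternatizeUncurryFin_zero, curryLeft_sub, _root_.sub_apply,
    ContinuousLinearMap.comp_apply, curryLeftAt_apply, lieBracket, map_sub]
  abel

end FlatCartan

section ManifoldCartan

open VectorField

variable {E : Type*} [NormedAddCommGroup E] [NormedSpace ℝ E]
  {M : Type*} [TopologicalSpace M] [ChartedSpace E M]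

theorem extChartAt_target_mem_nhds_self (x : M) :
    (extChartAt 𝓘(ℝ, E) x).target ∈ 𝓝 (extChartAt 𝓘(ℝ, E) x x) :=
  (isOpen_extChartAt_target x).mem_nhds (mem_extChartAt_target x)

theorem DiffForm.contDiffAt_chartRep (η : DiffForm E M) (x : M) (p : ℕ) :
    ContDiffAt ℝ ∞ (chartRep x p η.1) (extChartAt 𝓘(ℝ, E) x x) :=
  (η.2 x p).contDiffAt (extChartAt_target_mem_nhds_self x)

theorem DiffForm.differentiableAt_chartRep (η : DiffForm E M) (x : M) (p : ℕ) :
    DifferentiableAt ℝ (chartRep x p η.1) (extChartAt 𝓘(ℝ, E) x x) :=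
  (η.contDiffAt_chartRep x p).differentiableAt (by simp)

theorem DiffForm.ext {η θ : DiffForm E M} (h : ∀ x p, η.1 x p = θ.1 x p) : η = θ :=
  Subtype.ext (funext fun x => funext fun p => h x p)

variable [IsManifold 𝓘(ℝ, E) ∞ M]

theorem isInvertible_mfderiv_chart_symm (x₀ : M) {y : E}
    (hy : y ∈ (extChartAt 𝓘(ℝ, E) x₀).target) :
    (mfderiv 𝓘(ℝ, E) 𝓘(ℝ, E) (extChartAt 𝓘(ℝ, E) x₀).symm y).IsInvertible := by
  have : IsManifold 𝓘(ℝ, E) 1 M := IsManifold.of_le (n := ∞) (by exact_mod_cast le_top)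
  have h := isInvertible_mfderivWithin_extChartAt_symm (I := 𝓘(ℝ, E)) hy
  rwa [modelWithCornersSelf_coe, Set.range_id, mfderivWithin_univ] at h

theorem eq_of_chartRep_eq {x₀ : M} {p : ℕ} {η θ : RoughForm E M} {y : E}
    (hy : y ∈ (extChartAt 𝓘(ℝ, E) x₀).target) (h : chartRep x₀ p η y = chartRep x₀ p θ y) :
    η ((extChartAt 𝓘(ℝ, E) x₀).symm y) p = θ ((extChartAt 𝓘(ℝ, E) x₀).symm y) p := by
  ext v
  choose u hu using fun i => (isInvertible_mfderiv_chart_symm x₀ hy).bijective.surjective (v i)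
  obtain rfl : _ = v := funext hu
  exact DFunLike.congr_fun h u

theorem DiffForm.ext_chartRep {η θ : DiffForm E M}
    (h : ∀ x p, chartRep x p η.1 (extChartAt 𝓘(ℝ, E) x x) =
      chartRep x p θ.1 (extChartAt 𝓘(ℝ, E) x x)) : η = θ :=
  DiffForm.ext fun x p => by
    simpa only [extChartAt_to_inv] using eq_of_chartRep_eq (mem_extChartAt_target x) (h x p)

/-- A vector field written in the chart at `x₀`. -/
def chartVField (x₀ : M) (X : (x : M) → TangentSpace 𝓘(ℝ, E) x) (y : E) : E :=
  mpullbackWithin 𝓘(ℝ, E) 𝓘(ℝ, E) (extChartAt 𝓘(ℝ, E) x₀).symm X (Set.range 𝓘(ℝ, E)) y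

theorem mfderiv_chartVField (x₀ : M) (X : (x : M) → TangentSpace 𝓘(ℝ, E) x) {y : E}
    (hy : y ∈ (extChartAt 𝓘(ℝ, E) x₀).target) :
    (mfderiv 𝓘(ℝ, E) 𝓘(ℝ, E) (extChartAt 𝓘(ℝ, E) x₀).symm y : E → E) (chartVField (E := E) x₀ X y) =
      X ((extChartAt 𝓘(ℝ, E) x₀).symm y) := by
  have h := (isInvertible_mfderiv_chart_symm x₀ hy).self_apply_inverse
    (X ((extChartAt 𝓘(ℝ, E) x₀).symm y))
  simp only [chartVField, mpullbackWithin, modelWithCornersSelf_coe, Set.range_id,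
    mfderivWithin_univ]
  exact h

theorem chartRep_extD (η : DiffForm E M) (x₀ : M) (p : ℕ) {y : E}
    (hy : y ∈ (extChartAt 𝓘(ℝ, E) x₀).target) :
    chartRep x₀ (p + 1) (extD η).1 y = extDeriv (chartRep x₀ p η.1) y :=
  chartRep_roughExtDeriv η.2 x₀ p hy

theorem chartRep_extD_zero (η : DiffForm E M) (x₀ : M) (y : E) : chartRep x₀ 0 (extD η).1 y = 0 :=
  rfl

theorem extD_extD (η : DiffForm E M) : extD (extD η) = 0 := by
  refine DiffForm.ext_chartRep fun x p => ?_
  have hx := mem_extChartAt_target (I := 𝓘(ℝ, E)) x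
  rcases p with _ | _ | p
  · rfl
  · rw [chartRep_extD _ _ _ hx, funext (chartRep_extD_zero η x)]
    simp only [extDeriv, fderiv_fun_const]
    exact map_zero (ContinuousAlternatingMap.alternatizeUncurryFinCLM ℝ E ℝ)
  · rw [chartRep_extD _ _ _ hx, Filter.EventuallyEq.extDeriv_eq
      (Filter.eventually_of_mem (extChartAt_target_mem_nhds_self x) fun y => chartRep_extD η x p)]
    exact extDeriv_extDeriv_apply (η.contDiffAt_chartRep x p)
      (by simpa using (WithTop.coe_le_coe.2 le_top : ((2 : ℕ∞) : WithTop ℕ∞) ≤ ∞))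

section Complete

variable [CompleteSpace E]

theorem contDiffOn_chartVField (x₀ : M) (X : VField E M) :
    ContDiffOn ℝ ∞ (chartVField x₀ X) (extChartAt 𝓘(ℝ, E) x₀).target := by
  intro y hy
  have h := ContMDiffWithinAt.mpullbackWithin_vectorField_inter (I := 𝓘(ℝ, E)) (I' := 𝓘(ℝ, E))
    (f := (extChartAt 𝓘(ℝ, E) x₀).symm) (s := Set.range 𝓘(ℝ, E)) (t := Set.univ) (x₀ := y)
    (m := ∞) (n := ∞) (V := fun x => X x) (X.contMDiff _).contMDiffWithinAt
    (((contMDiffOn_extChartAt_symm (I := 𝓘(ℝ, E)) (n := ∞) x₀).contMDiffAt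
      ((isOpen_extChartAt_target x₀).mem_nhds hy)).contMDiffWithinAt)
    (isInvertible_mfderivWithin_extChartAt_symm hy) (by simp) (by simpa using uniqueMDiffOn_univ)
    (by simp)
  have h_flat := (contMDiffWithinAt_vectorSpace_iff_contDiffWithinAt (V := chartVField x₀ X)).1 h
  exact h_flat.mono (by simp)

theorem differentiableAt_chartVField (x : M) (X : VField E M) :
    DifferentiableAt ℝ (chartVField x X) (extChartAt 𝓘(ℝ, E) x x) :=
  ((contDiffOn_chartVField x X).contDiffAt (extChartAt_target_mem_nhds_self x)).differentiableAt
    (by simp)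

/-- The Lie bracket of smooth vector fields. -/
def lie (X Y : VField E M) : VField E M :=
  ⟨fun x => mlieBracket 𝓘(ℝ, E) (fun x => X x) (fun x => Y x) x, by
    have : IsManifold 𝓘(ℝ, E) (minSmoothness ℝ 3) M := by
      have h3 : (3 : WithTop ℕ∞) ≤ ∞ :=
        (WithTop.coe_le_coe.2 le_top : ((3 : ℕ∞) : WithTop ℕ∞) ≤ ∞)
      simpa using IsManifold.of_le (n := ∞) h3
    have : IsManifold 𝓘(ℝ, E) ((((⊤ : ℕ∞) : WithTop ℕ∞)) + 1) M := by simpa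
    intro x
    exact ContMDiffAt.mlieBracket_vectorField (n := ⊤) (m := ⊤) (X.contMDiff x) (Y.contMDiff x)
      (by simp)⟩

theorem chartVField_lie (x : M) (X Y : VField E M) :
    chartVField x (lie X Y) (extChartAt 𝓘(ℝ, E) x x) =
      lieBracket ℝ (chartVField x X) (chartVField x Y) (extChartAt 𝓘(ℝ, E) x x) := by
  have : IsManifold 𝓘(ℝ, E) 1 M := IsManifold.of_le (n := ∞) (by exact_mod_cast le_top)
  have h := (eventuallyEq_mpullback_mpullbackWithin_extChartAt (I := 𝓘(ℝ, E)) (s := Set.univ)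
    (x := x) fun z => lie X Y z).eq_of_nhdsWithin (Set.mem_univ x)
  have lie_apply : lie X Y x =
      mlieBracketWithin 𝓘(ℝ, E) (fun x => X x) (fun x => Y x) Set.univ x := rfl
  rw [lie_apply, mlieBracketWithin_apply, mpullback_apply] at h
  have h_chart := (isInvertible_mfderiv_extChartAt (I := 𝓘(ℝ, E))
    (mem_extChartAt_source (I := 𝓘(ℝ, E)) x)).inverse.injective h
  have hs : (extChartAt 𝓘(ℝ, E) x).symm ⁻¹' Set.univ ∩ Set.range 𝓘(ℝ, E) = Set.univ := by simp
  rw [hs] at h_chart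
  change lieBracketWithin ℝ (chartVField x X) (chartVField x Y) Set.univ _ =
    chartVField x (lie X Y) _ at h_chart
  rw [← h_chart, lieBracketWithin_univ]

end Complete

variable [FiniteDimensional ℝ E]

theorem chartRep_contract (X : VField E M) (η : DiffForm E M) (x₀ : M) (p : ℕ) {y : E}
    (hy : y ∈ (extChartAt 𝓘(ℝ, E) x₀).target) :
    chartRep x₀ p (contract X η).1 y =
      (chartRep x₀ (p + 1) η.1 y).curryLeft (chartVField x₀ X y) := by
  have h := mfderiv_chartVField x₀ (fun x => X x) hy
  unfold chartRep
  erw [ContinuousAlternatingMap.curryLeft_compContinuousLinearMap]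
  erw [h]
  rfl

theorem extDeriv_chartRep_contract (X : VField E M) (η : DiffForm E M) (x : M) (p : ℕ) :
    extDeriv (chartRep x p (contract X η).1) (extChartAt 𝓘(ℝ, E) x x) =
      extDeriv (fun y => (chartRep x (p + 1) η.1 y).curryLeft (chartVField x X y))
        (extChartAt 𝓘(ℝ, E) x x) :=
  Filter.EventuallyEq.extDeriv_eq (Filter.eventually_of_mem (extChartAt_target_mem_nhds_self x)
    fun _ => chartRep_contract X η x p)

theorem extDeriv_chartRep_contract_contract (X Y : VField E M) (η : DiffForm E M) (x : M) (p : ℕ) :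
    extDeriv (chartRep x p (contract X (contract Y η)).1) (extChartAt 𝓘(ℝ, E) x x) =
      extDeriv (fun y => ((chartRep x (p + 2) η.1 y).curryLeft (chartVField x Y y)).curryLeft
        (chartVField x X y)) (extChartAt 𝓘(ℝ, E) x x) :=
  Filter.EventuallyEq.extDeriv_eq (Filter.eventually_of_mem (extChartAt_target_mem_nhds_self x)
    fun y hy => by
      rw [chartRep_contract X _ x p hy, chartRep_contract Y η x (p + 1) hy])

theorem lieDeriv_apply (X : VField E M) (η : DiffForm E M) :
    lieDeriv X η = extD (contract X η) + contract X (extD η) :=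
  rfl

theorem lieDeriv_contract (X Y : VField E M) (η : DiffForm E M) :
    lieDeriv X (contract Y η) = contract Y (lieDeriv X η) + contract (lie X Y) η := by
  refine DiffForm.ext_chartRep fun x p => ?_
  have hx := mem_extChartAt_target (I := 𝓘(ℝ, E)) x
  have hX := differentiableAt_chartVField x X
  have hY := differentiableAt_chartVField x Y
  simp only [lieDeriv_apply, DiffForm.add_val, chartRep_add, Pi.add_apply]
  rw [← sub_eq_iff_eq_add']
  simp only [DiffForm.add_val, chartRep_add, Pi.add_apply, chartRep_contract _ _ _ _ hx,
    chartRep_extD _ _ _ hx, extDeriv_chartRep_contract, chartVField_lie]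
  cases p with
  | zero =>
    rw [chartRep_extD_zero, zero_add]
    exact extDeriv_curryLeft_commutator_one (η.differentiableAt_chartRep x 1) hX hY
  | succ p =>
    rw [chartRep_extD _ _ _ hx, extDeriv_chartRep_contract_contract]
    exact extDeriv_curryLeft_commutator (η.differentiableAt_chartRep x (p + 2)) hX hY

theorem contract_add (X Y : VField E M) (η : DiffForm E M) :
    contract (X + Y) η = contract X η + contract Y η :=
  Subtype.ext <| funext fun x =>
    LinearMap.congr_fun (map_add (contractVec (E := E)) (X x) (Y x)) (η.1 x)

theorem contract_smul (c : ℝ) (X : VField E M) (η : DiffForm E M) :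
    contract (c • X) η = c • contract X η :=
  Subtype.ext <| funext fun x =>
    LinearMap.congr_fun (map_smul (contractVec (E := E)) c (X x)) (η.1 x)

theorem contract_contract_self (X : VField E M) (η : DiffForm E M) :
    contract X (contract X η) = 0 :=
  Subtype.ext <| funext fun x => contractVec_contractVec (E := E) (X x) (η.1 x)

variable (E M) in
/-- The interior product as a linear map on vector fields. -/
def contractHom : VField E M →ₗ[ℝ] Module.End ℝ (DiffForm E M) where
  toFun := contract
  map_add' := fun X Y => LinearMap.ext fun η => contract_add X Y η
  map_smul' := fun c X => LinearMap.ext fun η => contract_smul c X η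

variable (E M) in
/-- The Cartan calculus of differential forms on the manifold `M`. -/
def formCalculus : CartanCalculus ℝ (VField E M) (DiffForm E M) where
  d := extD
  ι := contractHom E M
  bracket := lie
  d_d := extD_extD
  ι_ι_self := contract_contract_self
  d_ι_ι_add_ι_d_ι := fun X Y η => lieDeriv_contract X Y η

end ManifoldCartan

section Degrees

variable {E : Type*} [NormedAddCommGroup E] [NormedSpace ℝ E]
  {M : Type*} [TopologicalSpace M] [ChartedSpace E M]

theorem degreeProj_val_of_mem {S : Set ℕ} {p : ℕ} (hp : p ∈ S) (η : DiffForm E M) (x : M) :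
    (degreeProj S η).1 x p = η.1 x p :=
  if_pos hp

theorem degreeProj_val_of_notMem {S : Set ℕ} {p : ℕ} (hp : p ∉ S) (η : DiffForm E M) (x : M) :
    (degreeProj S η).1 x p = 0 :=
  if_neg hp

theorem degreeProj_eq_self {S : Set ℕ} {j : ℤ} {η : DiffForm E M} (hη : η ∈ formsOfDegree E M j)
    (h : ∀ p : ℕ, (p : ℤ) = j → p ∈ S) : degreeProj S η = η := by
  refine DiffForm.ext fun x p => ?_
  by_cases hp : p ∈ S
  · exact degreeProj_val_of_mem hp η x
  · rw [degreeProj_val_of_notMem hp, hη x p fun hj => hp (h p hj)]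

theorem degreeProj_eq_zero {S : Set ℕ} {j : ℤ} {η : DiffForm E M} (hη : η ∈ formsOfDegree E M j)
    (h : ∀ p : ℕ, (p : ℤ) = j → p ∉ S) : degreeProj S η = 0 := by
  refine DiffForm.ext fun x p => ?_
  by_cases hp : p ∈ S
  · exact (degreeProj_val_of_mem hp η x).trans (hη x p fun hj => h p hj hp)
  · exact degreeProj_val_of_notMem hp η x

theorem formsOfDegree_eq_bot {j : ℤ} (hj : j < 0) : formsOfDegree E M j = ⊥ :=
  (Submodule.eq_bot_iff _).2 fun _ hη => DiffForm.ext fun x p => hη x p (by lia)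

theorem iSupIndep_formsOfDegree : iSupIndep (formsOfDegree E M) := by
  intro j
  have other_degrees_le : ⨆ i, ⨆ (_ : i ≠ j), formsOfDegree E M i ≤
      LinearMap.ker (degreeProj {p | (p : ℤ) = j}) :=
    iSup₂_le fun i hi θ hθ => degreeProj_eq_zero hθ fun p hp hpj => hi (hp.symm.trans hpj)
  rw [Submodule.disjoint_def]
  intro η hη hη'
  rw [← degreeProj_eq_self hη fun p hp => hp]
  exact other_degrees_le hη'

variable [IsManifold 𝓘(ℝ, E) ∞ M]

theorem extD_val_congr {η θ : DiffForm E M} {p : ℕ} (h : ∀ x, η.1 x p = θ.1 x p) (x : M) :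
    (extD η).1 x (p + 1) = (extD θ).1 x (p + 1) := by
  have chartRep_eq : chartRep x p η.1 = chartRep x p θ.1 :=
    funext fun y => congrArg
      (·.compContinuousLinearMap (mfderiv 𝓘(ℝ, E) 𝓘(ℝ, E) (extChartAt 𝓘(ℝ, E) x).symm y)) (h _)
  exact congrArg (fun r => (extDeriv r (extChartAt 𝓘(ℝ, E) x x)).compContinuousLinearMap
    (mfderiv 𝓘(ℝ, E) 𝓘(ℝ, E) (extChartAt 𝓘(ℝ, E) x) x)) chartRep_eq

theorem extD_val_eq_zero {η : DiffForm E M} {p : ℕ} (h : ∀ x, η.1 x p = 0) (x : M) :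
    (extD η).1 x (p + 1) = 0 := by
  rw [extD_val_congr (θ := 0) h, map_zero]
  rfl

theorem extD_mem_formsOfDegree {j : ℤ} {η : DiffForm E M} (hη : η ∈ formsOfDegree E M j) :
    extD η ∈ formsOfDegree E M (j + 1) := by
  rintro x (_ | p) hp
  · rfl
  · exact extD_val_eq_zero (fun y => hη y p (by lia)) x

theorem degreeProj_extD (S : Set ℕ) (η : DiffForm E M) :
    degreeProj S (extD η) = extD (degreeProj {p | p + 1 ∈ S} η) := by
  refine DiffForm.ext fun x p => ?_
  rcases p with _ | p
  · exact ite_self 0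
  by_cases hp : p + 1 ∈ S
  · rw [degreeProj_val_of_mem hp]
    exact extD_val_congr (fun y => (degreeProj_val_of_mem (S := {p | p + 1 ∈ S}) hp η y).symm) x
  · rw [degreeProj_val_of_notMem hp]
    exact (extD_val_eq_zero (degreeProj_val_of_notMem (S := {p | p + 1 ∈ S}) hp η) x).symm

variable [FiniteDimensional ℝ E]

theorem contract_mem_formsOfDegree {j : ℤ} (X : VField E M) {η : DiffForm E M}
    (hη : η ∈ formsOfDegree E M j) : contract X η ∈ formsOfDegree E M (j - 1) := by
  intro x p hp
  change (η.1 x (p + 1)).curryLeft (X x) = 0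
  rw [hη x (p + 1) (by lia)]
  rfl

theorem iterContract_mem_formsOfDegree {k : ℕ} {j : ℤ} (X : Fin k → VField E M)
    {η : DiffForm E M} (hη : η ∈ formsOfDegree E M j) :
    (formCalculus E M).iterContract k X η ∈ formsOfDegree E M (j - k) := by
  induction k generalizing j η with
  | zero => simpa [CartanCalculus.iterContract_zero] using hη
  | succ k ih =>
    rw [← Fin.cons_self_tail X, CartanCalculus.iterContract_cons]
    have h := ih (Fin.tail X) (contract_mem_formsOfDegree (X 0) hη)
    rwa [sub_sub, add_comm (1 : ℤ), ← Nat.cast_succ] at h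

end Degrees

section MultivectorFields

variable {E : Type*} [NormedAddCommGroup E] [NormedSpace ℝ E]

theorem ιMulti_one (v : Fin 1 → E) :
    ExteriorAlgebra.ιMulti ℝ 1 v = ExteriorAlgebra.ι ℝ (v 0) := by
  rw [ExteriorAlgebra.ιMulti_succ_apply, ExteriorAlgebra.ιMulti_zero_apply, mul_one]

theorem unop_contractMulti_ι (v : E) (τ : (p : ℕ) → E [⋀^Fin p]→L[ℝ] ℝ) :
    (contractMulti (ExteriorAlgebra.ι ℝ v)).unop τ = contractVec v τ := by
  rw [contractMulti, ExteriorAlgebra.lift_ι_apply]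
  rfl

theorem unop_contractMulti_ιMulti_cons {k : ℕ} (v : Fin (k + 1) → E)
    (τ : (p : ℕ) → E [⋀^Fin p]→L[ℝ] ℝ) :
    (contractMulti (ExteriorAlgebra.ιMulti ℝ (k + 1) v)).unop τ =
      (contractMulti (ExteriorAlgebra.ιMulti ℝ k (Fin.tail v))).unop (contractVec (v 0) τ) := by
  rw [ExteriorAlgebra.ιMulti_succ_apply, map_mul, MulOpposite.unop_mul, Module.End.mul_apply,
    unop_contractMulti_ι]
  rfl

variable {M : Type*} [TopologicalSpace M] [ChartedSpace E M]

/-- The contraction of the form `w` with multivector fields, without smoothness assumption. -/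
def contractMultiHom (w : DiffForm E M) : (M → ExteriorAlgebra ℝ E) →ₗ[ℝ] RoughForm E M :=
  LinearMap.pi fun x => LinearMap.applyₗ (w.1 x) ∘ₗ
    (MulOpposite.opLinearEquiv ℝ).symm.toLinearMap ∘ₗ contractMulti.toLinearMap ∘ₗ
      LinearMap.proj x

variable [IsManifold 𝓘(ℝ, E) ∞ M]

/-- The value of a vector field at a point; as a linear map with values in `E`, it hides that the
tangent space is a copy of `E`. -/
def evalAt (x : M) : VField E M →ₗ[ℝ] E where
  toFun X := X x
  map_add' _ _ := rfl
  map_smul' _ _ := rfl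

theorem exists_local_vField_of_mem_multiVField_one {P : M → ExteriorAlgebra ℝ E}
    (hP : P ∈ MultiVField E M 1) (x₀ : M) :
    ∃ U : Set M, IsOpen U ∧ x₀ ∈ U ∧ ∃ Y : (x : M) → TangentSpace 𝓘(ℝ, E) x,
      ContMDiffOn 𝓘(ℝ, E) 𝓘(ℝ, E).tangent ∞
        (fun x => (⟨x, Y x⟩ : TangentBundle 𝓘(ℝ, E) M)) U ∧
      ∀ x ∈ U, P x = ExteriorAlgebra.ι ℝ (M := E) (Y x) := by
  obtain ⟨U, hU, hx₀, N, f, X, hf, hX, hPX⟩ := hP x₀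
  refine ⟨U, hU, hx₀, fun x => ∑ a, f a x • X a 0 x,
    ContMDiffOn.sum_section fun a _ => (hf a).smul_section (hX a 0), fun x hx => ?_⟩
  rw [hPX x hx]
  refine .trans (Finset.sum_congr rfl fun a _ => ?_)
    (map_sum (ExteriorAlgebra.ι ℝ (M := E)) _ _).symm
  exact (congrArg (f a x • ·) (ιMulti_one _)).trans
    (map_smul (ExteriorAlgebra.ι ℝ (M := E)) _ _).symm

theorem exists_vField_of_mem_multiVField_one {P : M → ExteriorAlgebra ℝ E}
    (hP : P ∈ MultiVField E M 1) :
    ∃ X : VField E M, ∀ x, P x = ExteriorAlgebra.ι ℝ (evalAt x X) := by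
  have ιInv_ι := ExteriorAlgebra.ι_leftInverse (R := ℝ) (M := E)
  refine ⟨⟨fun x => (ExteriorAlgebra.ιInv (R := ℝ) (M := E) (P x) : E), fun x₀ => ?_⟩, fun x => ?_⟩
  · obtain ⟨U, hU, hx₀, Y, hY, hPY⟩ := exists_local_vField_of_mem_multiVField_one hP x₀
    refine (hY.contMDiffAt (hU.mem_nhds hx₀)).congr_of_eventuallyEq
      (Filter.eventually_of_mem (hU.mem_nhds hx₀) fun x hx => ?_)
    exact congrArg (fun v : E => (⟨x, v⟩ : TangentBundle 𝓘(ℝ, E) M))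
      ((congrArg ExteriorAlgebra.ιInv (hPY x hx)).trans (ιInv_ι (Y x)))
  · obtain ⟨U, -, hx, Y, -, hPY⟩ := exists_local_vField_of_mem_multiVField_one hP x
    change P x = ExteriorAlgebra.ι ℝ (ExteriorAlgebra.ιInv (P x))
    rw [hPY x hx]
    exact congrArg (ExteriorAlgebra.ι ℝ) (ιInv_ι (Y x)).symm

theorem ιMulti_mem_multiVField {k : ℕ} (X : Fin k → VField E M) :
    (fun x => ExteriorAlgebra.ιMulti ℝ k fun i => evalAt x (X i)) ∈ MultiVField E M k :=
  fun _ => ⟨Set.univ, isOpen_univ, trivial, 1, fun _ _ => 1, fun _ i x => X i x,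
    fun _ => contMDiffOn_const, fun _ i => (X i).contMDiff.contMDiffOn, fun x _ => by
      rw [Fin.sum_univ_one, one_smul]; rfl⟩

/-- The contractions of the form `w` with smooth `k`-vector fields. -/
def multiContractions (w : DiffForm E M) (k : ℕ) : Submodule ℝ (DiffForm E M) :=
  ((MultiVField E M k).map (contractMultiHom w)).comap (smoothForms E M).subtype

theorem mem_hamiltonianMultiForms {n : ℕ} {w : DiffForm E M} {k : ℕ} {α : DiffForm E M} :
    α ∈ hamiltonianMultiForms n w k ↔
      α ∈ formsOfDegree E M (n - k) ∧ extD α ∈ multiContractions w k := by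
  refine and_congr_right fun _ => ⟨?_, ?_⟩
  · rintro ⟨P, hP, hPα⟩
    refine ⟨-P, neg_mem hP, ?_⟩
    rw [map_neg, neg_eq_iff_eq_neg]
    exact funext fun x => (neg_eq_iff_eq_neg.2 (hPα x)).symm
  · rintro ⟨P, hP, hPα⟩
    refine ⟨-P, neg_mem hP, fun x => ?_⟩
    rw [Pi.neg_apply, map_neg, MulOpposite.unop_neg, LinearMap.neg_apply, neg_neg]
    exact (congrFun hPα x).symm

variable [FiniteDimensional ℝ E]

theorem iterContract_val {k : ℕ} (X : Fin k → VField E M) (τ : DiffForm E M) (x : M) :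
    ((formCalculus E M).iterContract k X τ).1 x =
      (contractMulti (ExteriorAlgebra.ιMulti ℝ k fun i => evalAt x (X i))).unop (τ.1 x) := by
  induction k generalizing τ with
  | zero =>
    rw [CartanCalculus.iterContract_zero, ExteriorAlgebra.ιMulti_zero_apply, map_one]
    rfl
  | succ k ih =>
    rw [← Fin.cons_self_tail X, CartanCalculus.iterContract_cons, ih,
      unop_contractMulti_ιMulti_cons]
    rfl

theorem iterContract_mem_multiContractions {k : ℕ} (X : Fin k → VField E M) (w : DiffForm E M) :
    (formCalculus E M).iterContract k X w ∈ multiContractions w k :=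
  ⟨_, ιMulti_mem_multiVField X, funext fun x => (iterContract_val X w x).symm⟩

theorem hamiltonianMultiForms_one_le (n : ℕ) (w : DiffForm E M) :
    hamiltonianMultiForms n w 1 ≤ hamiltonianForms n w := by
  rintro α ⟨hα, P, hP, hPα⟩
  obtain ⟨X, hX⟩ := exists_vField_of_mem_multiVField_one hP
  refine ⟨by simpa using hα, X, Subtype.ext (funext fun x => ?_)⟩
  rw [hPα, hX, unop_contractMulti_ι]
  rfl

end MultivectorFields

section Observables

theorem zeta_one : zeta 1 = 1 := by
  norm_num [zeta]

theorem zeta_succ (k : ℕ) : zeta (k + 1) = (-1) ^ (k + 1) * zeta k := by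
  have triangle_succ : (k + 1) * (k + 1 + 1) / 2 = k * (k + 1) / 2 + (k + 1) := by
    simpa [mul_comm] using Nat.triangle_succ (k + 1)
  rw [zeta, zeta, triangle_succ, pow_add, mul_neg, mul_comm]

theorem zeta_succ_smul {V : Type*} [AddCommGroup V] [Module ℝ V] (k : ℕ) (v : V) :
    zeta (k + 1) • ((-1 : ℤˣ) ^ k) • v = -(zeta k • v) := by
  rw [zeta_succ]
  rcases k.even_or_odd with hk | hk
  · rw [hk.neg_one_pow, hk.add_one.neg_one_pow, one_smul, neg_one_mul, neg_smul]
  · rw [hk.neg_one_pow, hk.add_one.neg_one_pow, one_mul, Units.neg_smul, one_smul, smul_neg]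

theorem koszulSign_smul_eq {V : Type*} [AddCommGroup V] {k : ℕ} {d : Fin k → ℤ} {v : V}
    (hv : (∃ a, d a ≠ 0) → v = 0) (σ : Equiv.Perm (Fin k)) : koszulSign d σ • v = v := by
  by_cases hd : ∃ a, d a ≠ 0
  · rw [hv hd, smul_zero]
  · rw [koszulSign_of_forall_eq_zero (by simpa using hd), one_smul]

variable {E : Type*} [NormedAddCommGroup E] [NormedSpace ℝ E] [FiniteDimensional ℝ E]
  {M : Type*} [TopologicalSpace M] [ChartedSpace E M] [IsManifold 𝓘(ℝ, E) ∞ M]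
  {n : ℕ} {w : DiffForm E M}

theorem foldl_ofFn_contract {k : ℕ} (X : Fin k → VField E M) (τ : DiffForm E M) :
    (List.ofFn X).foldl (fun τ X => contract X τ) τ = (formCalculus E M).iterContract k X τ := by
  induction k generalizing τ with
  | zero => rw [List.ofFn_zero, List.foldl_nil, CartanCalculus.iterContract_zero]
  | succ k ih =>
    rw [← Fin.cons_self_tail X, CartanCalculus.iterContract_cons, List.ofFn_cons, List.foldl_cons,
      ih]
    rfl

variable (n w) in
/-- The Hamiltonian vector field of the component of form degree `n - 1`, i.e. of degree `0` in
the Lie `n`-algebra of observables. -/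
def obsField (α : DiffForm E M) : VField E M :=
  hamVField w (degreeProj {p | p + 1 = n} α)

theorem obsBracket_one (α : Fin 1 → DiffForm E M) :
    obsBracket n w 1 α = extD (degreeProj {p | p + 1 < n} (α 0)) :=
  rfl

theorem obsBracket_add_two {k : ℕ} (α : Fin (k + 2) → DiffForm E M) :
    obsBracket n w (k + 2) α =
      zeta (k + 2) •
        (formCalculus E M).iterContract (k + 2) (fun a => obsField n w (α a)) w :=
  congrArg (zeta (k + 2) • ·) (foldl_ofFn_contract _ w)

theorem obsBracket_eq_zero {k : ℕ} (hk : 2 ≤ k) (α : Fin k → DiffForm E M) (a : Fin k)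
    (ha : obsField n w (α a) = 0) : obsBracket n w k α = 0 := by
  obtain ⟨k, rfl⟩ := Nat.exists_eq_add_of_le' hk
  rw [obsBracket_add_two, AlternatingMap.map_coord_zero _ a ha, LinearMap.zero_apply, smul_zero]

theorem isHamiltonianVField_hamVField {α : DiffForm E M}
    (hα : ∃ X : VField E M, IsHamiltonianVField w α X) :
    IsHamiltonianVField w α (hamVField w α) := by
  rw [hamVField, dif_pos hα]
  exact hα.choose_spec

theorem IsHamiltonianVField.smul_add {α β : DiffForm E M} {X Y : VField E M}
    (hX : IsHamiltonianVField w α X) (hY : IsHamiltonianVField w β Y) (c : ℝ) :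
    IsHamiltonianVField w (c • α + β) (c • X + Y) := by
  rw [IsHamiltonianVField] at hX hY ⊢
  rw [map_add, map_smul, hX, hY, contract_add, contract_smul, smul_neg, neg_add]

theorem obsField_eq_hamVField {α : DiffForm E M} (hα : α ∈ formsOfDegree E M (n - 1)) :
    obsField n w α = hamVField w α := by
  rw [obsField, degreeProj_eq_self hα fun p hp => by rw [Set.mem_ofPred_eq]; lia]

theorem isHamiltonianVField_obsField {α : DiffForm E M} (hα : α ∈ hamiltonianForms n w) :
    IsHamiltonianVField w α (obsField n w α) := by
  rw [obsField_eq_hamVField hα.1]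
  exact isHamiltonianVField_hamVField hα.2

namespace IsNPlectic

theorem eq_zero_of_contract_eq_zero (hw : IsNPlectic n w) {X : VField E M}
    (hX : contract X w = 0) : X = 0 := by
  ext x
  exact hw.nondegenerate x (X x) (congrFun (congrArg Subtype.val hX) x)

theorem hamVField_eq (hw : IsNPlectic n w) {α : DiffForm E M} {X : VField E M}
    (hX : IsHamiltonianVField w α X) : hamVField w α = X := by
  have contract_eq : contractHom E M (hamVField w α) w = contractHom E M X w :=
    neg_injective ((isHamiltonianVField_hamVField ⟨X, hX⟩).symm.trans hX)
  refine sub_eq_zero.1 (hw.eq_zero_of_contract_eq_zero ?_)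
  change contractHom E M (hamVField w α - X) w = 0
  rw [map_sub, LinearMap.sub_apply, contract_eq, sub_self]

theorem hamVField_eq_zero (hw : IsNPlectic n w) {α : DiffForm E M} (hα : extD α = 0) :
    hamVField w α = 0 :=
  hw.hamVField_eq (hα.trans (by
    change 0 = -contractHom E M 0 w
    rw [map_zero, LinearMap.zero_apply, neg_zero]))

theorem lieDeriv_of_isHamiltonianVField (hw : IsNPlectic n w) {α : DiffForm E M} {X : VField E M}
    (hX : IsHamiltonianVField w α X) : lieDeriv X w = 0 :=
  CartanCalculus.lieD_eq_zero_of_d_eq_neg_ι (C := formCalculus E M) hw.closed hX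

theorem lieDeriv_hamVField (hw : IsNPlectic n w) (α : DiffForm E M) :
    lieDeriv (hamVField w α) w = 0 := by
  by_cases hα : ∃ X : VField E M, IsHamiltonianVField w α X
  · exact hw.lieDeriv_of_isHamiltonianVField (isHamiltonianVField_hamVField hα)
  · rw [hamVField, dif_neg hα]
    change (formCalculus E M).lieD 0 w = 0
    rw [CartanCalculus.lieD_apply, map_zero, LinearMap.zero_apply, LinearMap.zero_apply, map_zero,
      add_zero]

theorem obsField_eq_zero (hw : IsNPlectic n w) {j : ℤ} {α : DiffForm E M}
    (hα : α ∈ formsOfDegree E M j) (hj : j ≠ n - 1) : obsField n w α = 0 := by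
  rw [obsField, degreeProj_eq_zero hα fun p hp => by rw [Set.mem_ofPred_eq]; lia]
  exact hw.hamVField_eq_zero (map_zero _)

theorem obsField_eq (hw : IsNPlectic n w) {α : DiffForm E M} {X : VField E M}
    (hα : α ∈ formsOfDegree E M (n - 1)) (hX : IsHamiltonianVField w α X) :
    obsField n w α = X :=
  (obsField_eq_hamVField hα).trans (hw.hamVField_eq hX)

theorem obsField_extD (hw : IsNPlectic n w) (α : DiffForm E M) : obsField n w (extD α) = 0 := by
  rw [obsField, degreeProj_extD]
  exact hw.hamVField_eq_zero (extD_extD _)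

theorem obsField_zero (hw : IsNPlectic n w) : obsField n w 0 = 0 :=
  hw.hamVField_eq_zero (by rw [map_zero, map_zero])

theorem obsBracket_mem_formsOfDegree (hw : IsNPlectic n w) {k : ℕ} (hk : 2 ≤ k)
    (α : Fin k → DiffForm E M) : obsBracket n w k α ∈ formsOfDegree E M (n + 1 - k) := by
  obtain ⟨k, rfl⟩ := Nat.exists_eq_add_of_le' hk
  rw [obsBracket_add_two]
  exact Submodule.smul_mem _ _ (iterContract_mem_formsOfDegree _ hw.degree)

theorem extD_obsBracket (hw : IsNPlectic n w) {k : ℕ} (α : Fin (k + 2) → DiffForm E M) :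
    extD (obsBracket n w (k + 2) α) =
      -(zeta (k + 1) • (formCalculus E M).bracketSum (fun a => obsField n w (α a)) w) := by
  have extD_iterContract := CartanCalculus.d_iterContract (C := formCalculus E M)
    (fun a => obsField n w (α a)) hw.closed fun _ => hw.lieDeriv_hamVField _
  rw [obsBracket_add_two, map_smul, ← zeta_succ_smul]
  exact congrArg (zeta (k + 2) • ·) extD_iterContract

theorem obsField_obsBracket_one (hw : IsNPlectic n w) (α : Fin 1 → DiffForm E M) :
    obsField n w (obsBracket n w 1 α) = 0 :=
  hw.obsField_extD _

theorem obsField_obsBracket_two (hw : IsNPlectic n w) (α : Fin 2 → DiffForm E M) :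
    obsField n w (obsBracket n w 2 α) = lie (obsField n w (α 0)) (obsField n w (α 1)) := by
  refine hw.obsField_eq ?_ ?_
  · convert hw.obsBracket_mem_formsOfDegree le_rfl α using 2
    push_cast
    ring
  · rw [IsHamiltonianVField, hw.extD_obsBracket, zeta_one, one_smul, CartanCalculus.bracketSum_two]
    rfl

theorem obsField_obsBracket_of_three_le (hw : IsNPlectic n w) {k : ℕ} (hk : 3 ≤ k)
    (α : Fin k → DiffForm E M) : obsField n w (obsBracket n w k α) = 0 :=
  hw.obsField_eq_zero (hw.obsBracket_mem_formsOfDegree (by lia) α) (by lia)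

theorem obsBracket_mem_hamiltonianMultiForms (hw : IsNPlectic n w) {k : ℕ}
    (α : Fin (k + 2) → DiffForm E M) :
    obsBracket n w (k + 2) α ∈ hamiltonianMultiForms n w (k + 1) := by
  refine mem_hamiltonianMultiForms.2 ⟨?_, ?_⟩
  · convert hw.obsBracket_mem_formsOfDegree (by lia) α using 2
    push_cast
    ring
  · rw [hw.extD_obsBracket]
    refine neg_mem (Submodule.smul_mem _ _ (Submodule.sum_mem _ fun σ _ => ?_))
    rw [Units.smul_def]
    exact zsmul_mem (iterContract_mem_multiContractions _ w) _

end IsNPlectic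

end Observables

section GradedSpaces

variable {E : Type*} [NormedAddCommGroup E] [NormedSpace ℝ E]
  {M : Type*} [TopologicalSpace M] [ChartedSpace E M] {n : ℕ}

theorem regrade_mono {S T : ℕ → Submodule ℝ (DiffForm E M)} (h : ∀ k, S k ≤ T k) (i : ℤ) :
    regrade n S i ≤ regrade n T i := by
  rw [regrade, regrade]
  split_ifs
  · exact h _
  · exact le_rfl

theorem regrade_zero_le (S : ℕ → Submodule ℝ (DiffForm E M)) : regrade n S 0 ≤ S 1 := by
  rw [regrade]
  split_ifs
  · exact le_rfl
  · exact bot_le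

variable [IsManifold 𝓘(ℝ, E) ∞ M] {w : DiffForm E M}

theorem extD_mem_hamiltonianMultiForms {k : ℕ} {α : DiffForm E M}
    (hα : α ∈ formsOfDegree E M (n - (k + 1 : ℕ))) : extD α ∈ hamiltonianMultiForms n w k := by
  rw [mem_hamiltonianMultiForms, extD_extD]
  refine ⟨?_, zero_mem _⟩
  convert extD_mem_formsOfDegree hα using 2
  push_cast
  ring

variable [FiniteDimensional ℝ E]

theorem observables_zero : observables n w 0 = hamiltonianForms n w :=
  if_pos rfl

theorem observables_le (i : ℤ) : observables n w i ≤ formsOfDegree E M (n - 1 - i) := by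
  rw [observables]
  split_ifs with h0 h
  · rw [h0, sub_zero]
    exact fun α hα => hα.1
  · exact le_rfl
  · exact bot_le

theorem observables_le_regrade (i : ℤ) :
    observables n w i ≤ regrade n (fun k => formsOfDegree E M (n - k)) i := by
  rw [regrade]
  split_ifs with hi
  · refine (observables_le i).trans (le_of_eq ?_)
    congr 1
    lia
  · rcases eq_or_ne i 0 with rfl | hi0
    · exact (observables_le 0).trans (formsOfDegree_eq_bot (by lia)).le
    · rw [observables, if_neg hi0, if_neg (by lia)]

theorem hamiltonianObservables_le (i : ℤ) :
    hamiltonianObservables n w i ≤ observables n w i := by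
  rw [hamiltonianObservables, regrade]
  split_ifs with hi
  · rcases eq_or_ne i 0 with rfl | hi0
    · rw [observables_zero]
      exact hamiltonianMultiForms_one_le n w
    · rw [observables, if_neg hi0, if_pos (by lia)]
      intro α hα
      convert hα.1 using 2
      lia
  · exact bot_le

theorem degreeProj_mem_hamiltonianForms {α : DiffForm E M} (hα : α ∈ ⨆ i, observables n w i) :
    degreeProj {p | p + 1 = n} α ∈ hamiltonianForms n w := by
  suffices h : ⨆ i, observables n w i ≤
      (hamiltonianForms n w).comap (degreeProj {p | p + 1 = n}) from h hα
  refine iSup_le fun i β hβ => ?_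
  rw [Submodule.mem_comap]
  rcases eq_or_ne i 0 with rfl | hi
  · rw [observables_zero] at hβ
    rwa [degreeProj_eq_self hβ.1 fun p hp => by rw [Set.mem_ofPred_eq]; lia]
  · rw [degreeProj_eq_zero (observables_le i hβ) fun p hp => by rw [Set.mem_ofPred_eq]; lia]
    exact zero_mem _

theorem obsBracket_one_mem_regrade {S T : ℕ → Submodule ℝ (DiffForm E M)}
    (hS : ∀ k, S k ≤ formsOfDegree E M (n - k)) (hST : ∀ k, ∀ α ∈ S (k + 1), extD α ∈ T k)
    {d : Fin 1 → ℤ} {x : Fin 1 → DiffForm E M} (hx : x 0 ∈ regrade n S (d 0)) :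
    obsBracket n w 1 x ∈ regrade n T ((∑ a, d a) + (1 : ℕ) - 2) := by
  have degree_eq : (∑ a, d a) + (1 : ℕ) - 2 = d 0 - 1 := by
    rw [Fin.sum_univ_one]
    lia
  rw [degree_eq, obsBracket_one]
  rw [regrade] at hx
  split_ifs at hx with hi
  · rcases eq_or_ne (d 0) 0 with hi0 | hi0
    · rw [degreeProj_eq_zero (hS _ hx) fun p hp => by rw [Set.mem_ofPred_eq]; lia, map_zero]
      exact zero_mem _
    · rw [degreeProj_eq_self (hS _ hx) fun p hp => by rw [Set.mem_ofPred_eq]; lia, regrade,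
        if_pos (by lia)]
      refine hST _ _ ?_
      convert hx using 2
      lia
  · rw [(Submodule.mem_bot ℝ).1 hx, map_zero, map_zero]
    exact zero_mem _

theorem strictlyConserved_le (X : VField E M) (k : ℕ) :
    strictlyConserved n w X k ≤ globallyConserved n w X k := by
  rintro α ⟨hα, hX⟩
  refine ⟨hα, ?_⟩
  change lieDeriv X α ∈ (formsOfDegree E M (n - k - 1)).map extD
  rw [LinearMap.mem_ker.1 hX]
  exact zero_mem _

theorem globallyConserved_le (X : VField E M) (k : ℕ) :
    globallyConserved n w X k ≤ locallyConserved n w X k := by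
  rintro α ⟨hα, β, -, hβ⟩
  refine ⟨hα, ?_⟩
  change extD (lieDeriv X α) = 0
  rw [← hβ, extD_extD]

end GradedSpaces

section LieNAlgebra

variable {E : Type*} [NormedAddCommGroup E] [NormedSpace ℝ E] [FiniteDimensional ℝ E]
  {M : Type*} [TopologicalSpace M] [ChartedSpace E M] [IsManifold 𝓘(ℝ, E) ∞ M]
  {n : ℕ} {w : DiffForm E M}

namespace IsNPlectic

theorem obsField_smul_add (hw : IsNPlectic n w) (c : ℝ) {α β : DiffForm E M}
    (hα : α ∈ ⨆ i, observables n w i) (hβ : β ∈ ⨆ i, observables n w i) :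
    obsField n w (c • α + β) = c • obsField n w α + obsField n w β := by
  have hX := isHamiltonianVField_hamVField (degreeProj_mem_hamiltonianForms hα).2
  have hY := isHamiltonianVField_hamVField (degreeProj_mem_hamiltonianForms hβ).2
  rw [obsField, map_add, map_smul]
  exact hw.hamVField_eq (hX.smul_add hY c)

theorem obsBracket_update_smul_add (hw : IsNPlectic n w) {k : ℕ} (hk : 1 ≤ k)
    (x : Fin k → DiffForm E M) (a : Fin k) {α β : DiffForm E M}
    (hα : α ∈ ⨆ i, observables n w i) (hβ : β ∈ ⨆ i, observables n w i) (c : ℝ) :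
    obsBracket n w k (Function.update x a (c • α + β)) =
      c • obsBracket n w k (Function.update x a α) + obsBracket n w k (Function.update x a β) := by
  rcases k with _ | _ | k
  · simp at hk
  · obtain rfl : a = (0 : Fin 1) := Subsingleton.elim (α := Fin 1) _ _
    change obsBracket n w 1 _ = c • obsBracket n w 1 _ + obsBracket n w 1 _
    simp only [obsBracket_one, Function.update_self, map_add, map_smul]
  · have obsField_update (γ : DiffForm E M) : (fun b => obsField n w (Function.update x a γ b)) =
        Function.update (fun b => obsField n w (x b)) a (obsField n w γ) :=
      funext fun b => Function.apply_update (fun _ => obsField n w) x a γ b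
    simp only [obsBracket_add_two, obsField_update, hw.obsField_smul_add c hα hβ,
      AlternatingMap.map_update_add, AlternatingMap.map_update_smul, LinearMap.add_apply,
      LinearMap.smul_apply, smul_add]
    rw [smul_comm]

theorem obsBracket_eq_zero_of_ne_zero (hw : IsNPlectic n w) {k : ℕ} (hk : 2 ≤ k)
    {d : Fin k → ℤ} {x : Fin k → DiffForm E M} (hx : ∀ a, x a ∈ observables n w (d a))
    (hd : ∃ a, d a ≠ 0) : obsBracket n w k x = 0 := by
  obtain ⟨a, ha⟩ := hd
  exact obsBracket_eq_zero hk x a (hw.obsField_eq_zero (observables_le _ (hx a)) (by lia))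

theorem obsBracket_comp_perm (hw : IsNPlectic n w) {k : ℕ} (hk : 1 ≤ k) {d : Fin k → ℤ}
    {x : Fin k → DiffForm E M} (hx : ∀ a, x a ∈ observables n w (d a))
    (σ : Equiv.Perm (Fin k)) :
    obsBracket n w k (fun a => x (σ a)) =
      (Equiv.Perm.sign σ * koszulSign d σ) • obsBracket n w k x := by
  rcases k with _ | _ | k
  · simp at hk
  · obtain rfl : σ = 1 := Subsingleton.elim (α := Equiv.Perm (Fin 1)) _ _
    rw [koszulSign_one, Equiv.Perm.sign_one, one_mul, one_smul]
    rfl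
  · have contract_perm := (formCalculus E M).iterContract (k + 2) |>.map_perm
      (fun a => obsField n w (x a)) σ
    rw [mul_smul, koszulSign_smul_eq (hw.obsBracket_eq_zero_of_ne_zero (by lia) hx),
      obsBracket_add_two, obsBracket_add_two, smul_comm]
    exact congrArg (zeta (k + 2) • · w) contract_perm

theorem obsBracket_cons_obsBracket_eq_zero (hw : IsNPlectic n w) (r s : ℕ) (hr : 1 ≤ r)
    (hr2 : r ≠ 2) (hs : 1 ≤ s) (α : Fin r → DiffForm E M) (β : Fin s → DiffForm E M) :
    obsBracket n w (s + 1) (Fin.cons (obsBracket n w r α) β) = 0 := by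
  refine obsBracket_eq_zero (by lia) _ 0 ?_
  rw [Fin.cons_zero]
  obtain rfl | hr3 : r = 1 ∨ 3 ≤ r := by lia
  · exact hw.obsField_obsBracket_one α
  · exact hw.obsField_obsBracket_of_three_le hr3 α

theorem obsBracket_cons_obsBracket_two (hw : IsNPlectic n w) {k : ℕ}
    (α : Fin 2 → DiffForm E M) (β : Fin (k + 1) → DiffForm E M) :
    obsBracket n w (k + 2) (Fin.cons (obsBracket n w 2 α) β) =
      zeta (k + 2) • (formCalculus E M).iterContract (k + 2)
        (Fin.cons (lie (obsField n w (α 0)) (obsField n w (α 1)))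
          fun b => obsField n w (β b)) w := by
  rw [obsBracket_add_two]
  congr 3
  funext a
  refine Fin.cases ?_ (fun b => ?_) a
  · rw [Fin.cons_zero, Fin.cons_zero, hw.obsField_obsBracket_two]
  · rw [Fin.cons_succ, Fin.cons_succ]

theorem obsBracket_cons_obsBracket_two_eq_zero (hw : IsNPlectic n w) {k : ℕ}
    {x : Fin (k + 3) → DiffForm E M} {a : Fin (k + 3)} (ha : obsField n w (x a) = 0)
    (σ : Equiv.Perm (Fin (k + 3))) :
    obsBracket n w (k + 2) (Fin.cons (obsBracket n w 2 ![x (σ 0), x (σ 1)])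
      fun b : Fin (k + 1) => x (σ b.succ.succ)) = 0 := by
  obtain ⟨c, rfl⟩ := σ.surjective a
  have inner_eq_zero (e : Fin 2) (he : obsField n w (![x (σ 0), x (σ 1)] e) = 0) :
      obsBracket n w (k + 2) (Fin.cons (obsBracket n w 2 ![x (σ 0), x (σ 1)])
        fun b : Fin (k + 1) => x (σ b.succ.succ)) = 0 := by
    refine obsBracket_eq_zero (by lia) _ 0 ?_
    rw [Fin.cons_zero, obsBracket_eq_zero le_rfl _ e he, hw.obsField_zero]
  induction c using Fin.cases with
  | zero => exact inner_eq_zero 0 ha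
  | succ c =>
    induction c using Fin.cases with
    | zero => exact inner_eq_zero 1 ha
    | succ b =>
      refine obsBracket_eq_zero (by lia) _ b.succ ?_
      rwa [Fin.cons_succ]

open Classical in
theorem sum_sign_smul_obsBracket_cons_obsBracket_two (hw : IsNPlectic n w) {k : ℕ}
    (x : Fin (k + 3) → DiffForm E M) :
    ∑ σ : Equiv.Perm (Fin (k + 3)) with IsUnshuffle 2 σ,
      Equiv.Perm.sign σ • obsBracket n w (k + 2)
        (Fin.cons (obsBracket n w 2 ![x (σ 0), x (σ 1)])
          fun b : Fin (k + 1) => x (σ b.succ.succ)) =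
      -extD (obsBracket n w (k + 3) x) := by
  rw [hw.extD_obsBracket, neg_neg, CartanCalculus.bracketSum, Finset.smul_sum]
  refine Finset.sum_congr rfl fun σ _ => ?_
  rw [hw.obsBracket_cons_obsBracket_two, smul_comm]
  rfl

theorem jacobiator_obsBracket_add_three (hw : IsNPlectic n w) {k : ℕ} {d : Fin (k + 3) → ℤ}
    {x : Fin (k + 3) → DiffForm E M} (hx : ∀ a, x a ∈ observables n w (d a)) :
    jacobiator (obsBracket n w) d x = 0 := by
  classical
  have drop_koszulSign (σ : Equiv.Perm (Fin (k + 3))) := koszulSign_smul_eq (d := d)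
    (fun ⟨a, ha⟩ => hw.obsBracket_cons_obsBracket_two_eq_zero
      (hw.obsField_eq_zero (observables_le _ (hx a)) (by lia)) σ) σ
  have outer_eq : obsBracket n w 1 (fun _ => obsBracket n w (k + 3) x) =
      extD (obsBracket n w (k + 3) x) := by
    rw [obsBracket_one, degreeProj_eq_self (hw.obsBracket_mem_formsOfDegree (by lia) x)
      fun p hp => by rw [Set.mem_ofPred_eq]; lia]
  rw [jacobiator_add_three hw.obsBracket_cons_obsBracket_eq_zero, outer_eq]
  simp only [mul_smul, drop_koszulSign]
  rw [hw.sum_sign_smul_obsBracket_cons_obsBracket_two, neg_add_cancel]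

theorem jacobiator_obsBracket (hw : IsNPlectic n w) {m : ℕ} (hm : 1 ≤ m) {d : Fin m → ℤ}
    {x : Fin m → DiffForm E M} (hx : ∀ a, x a ∈ observables n w (d a)) :
    jacobiator (obsBracket n w) d x = 0 := by
  rcases m with _ | _ | _ | k
  · simp at hm
  · refine (jacobiator_one d x).trans ?_
    rw [obsBracket_one, obsBracket_one, degreeProj_extD, extD_extD]
  · refine (jacobiator_two hw.obsBracket_cons_obsBracket_eq_zero d x).trans ?_
    rw [obsBracket_one, degreeProj_eq_zero (hw.obsBracket_mem_formsOfDegree le_rfl x)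
      fun p hp => by rw [Set.mem_ofPred_eq]; lia, map_zero]
  · exact hw.jacobiator_obsBracket_add_three hx

theorem obsBracket_add_two_mem_regrade (hw : IsNPlectic n w) {k : ℕ} {d : Fin (k + 2) → ℤ}
    {x : Fin (k + 2) → DiffForm E M} (hx : ∀ a, x a ∈ observables n w (d a))
    {S : ℕ → Submodule ℝ (DiffForm E M)}
    (hS : (∀ a, d a = 0) → obsBracket n w (k + 2) x ∈ S (k + 1)) :
    obsBracket n w (k + 2) x ∈ regrade n S ((∑ a, d a) + (k + 2 : ℕ) - 2) := by
  by_cases hd : ∀ a, d a = 0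
  · have degree_eq : (∑ a, d a) + (k + 2 : ℕ) - 2 = k := by
      simp only [hd, Finset.sum_const_zero]
      lia
    rw [degree_eq, regrade]
    split_ifs with hk
    · exact hS hd
    · have hmem := hw.obsBracket_mem_formsOfDegree (by lia) x
      rwa [formsOfDegree_eq_bot (by lia)] at hmem
  · rw [hw.obsBracket_eq_zero_of_ne_zero (by lia) hx (not_forall.1 hd)]
    exact zero_mem _

theorem obsBracket_mem_hamiltonianObservables (hw : IsNPlectic n w) {k : ℕ} (hk : 1 ≤ k)
    {d : Fin k → ℤ} {x : Fin k → DiffForm E M} (hx : ∀ a, x a ∈ observables n w (d a)) :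
    obsBracket n w k x ∈ hamiltonianObservables n w ((∑ a, d a) + k - 2) := by
  rcases k with _ | _ | k
  · simp at hk
  · exact obsBracket_one_mem_regrade (fun _ => le_rfl)
      (fun _ _ => extD_mem_hamiltonianMultiForms) (observables_le_regrade _ (hx 0))
  · exact hw.obsBracket_add_two_mem_regrade hx fun _ => hw.obsBracket_mem_hamiltonianMultiForms x

theorem isLInftyAlgebra_observables (hw : IsNPlectic n w) :
    IsLInftyAlgebra (observables n w) (obsBracket n w) where
  independent := (iSupIndep_formsOfDegree.comp (f := fun i : ℤ => (n : ℤ) - 1 - i)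
    (sub_right_injective (b := (n : ℤ) - 1))).mono observables_le
  degree _ hk _ _ hx :=
    hamiltonianObservables_le _ (hw.obsBracket_mem_hamiltonianObservables hk hx)
  multilinear _ hk x _ a _ hα _ hβ c := hw.obsBracket_update_smul_add hk x a hα hβ c
  skew _ hk _ _ hx σ := hw.obsBracket_comp_perm hk hx σ
  jacobi _ hm _ _ hx := hw.jacobiator_obsBracket hm hx

theorem isLieNAlgebra_observables (hw : IsNPlectic n w) :
    IsLieNAlgebra n (observables n w) (obsBracket n w) where
  toIsLInftyAlgebra := hw.isLInftyAlgebra_observables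
  eq_bot i hi := eq_bot_mono (observables_le i) (formsOfDegree_eq_bot (by lia))

theorem isLInftySubalgebra_hamiltonianObservables (hw : IsNPlectic n w) :
    IsLInftySubalgebra (hamiltonianObservables n w) (observables n w) (obsBracket n w) where
  ambient := hw.isLInftyAlgebra_observables
  le := hamiltonianObservables_le
  closed _ hk _ _ hx := hw.obsBracket_mem_hamiltonianObservables hk fun a =>
    hamiltonianObservables_le _ (hx a)

theorem lie_eq_zero_of_conserved (hw : IsNPlectic n w) {X Y : VField E M} {α : DiffForm E M}
    (hX : lieDeriv X w = 0) (hY : IsHamiltonianVField w α Y) (hα : extD (lieDeriv X α) = 0) :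
    lie X Y = 0 :=
  hw.eq_zero_of_contract_eq_zero
    (CartanCalculus.ι_bracket_eq_zero (C := formCalculus E M) hX hY hα)

theorem lieDeriv_obsBracket_eq_zero (hw : IsNPlectic n w) {X : VField E M}
    (hX : lieDeriv X w = 0) {k : ℕ} {x : Fin (k + 2) → DiffForm E M}
    (hx : ∀ a, x a ∈ locallyConserved n w X 1) : lieDeriv X (obsBracket n w (k + 2) x) = 0 := by
  have lie_eq_zero (a : Fin (k + 2)) : lie X (obsField n w (x a)) = 0 :=
    hw.lie_eq_zero_of_conserved hX
      (isHamiltonianVField_obsField (hamiltonianMultiForms_one_le n w (hx a).1)) (hx a).2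
  rw [obsBracket_add_two, map_smul]
  exact smul_eq_zero_of_right _
    (CartanCalculus.lieD_iterContract_eq_zero (C := formCalculus E M) hX lie_eq_zero)

theorem obsBracket_mem_strictlyConserved (hw : IsNPlectic n w) {X : VField E M}
    (hX : lieDeriv X w = 0) {k : ℕ} (hk : 1 ≤ k) {d : Fin k → ℤ} {x : Fin k → DiffForm E M}
    (hx : ∀ a, x a ∈ regrade n (locallyConserved n w X) (d a)) :
    obsBracket n w k x ∈ regrade n (strictlyConserved n w X) ((∑ a, d a) + k - 2) := by
  rcases k with _ | _ | k
  · simp at hk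
  · have extD_mem (k : ℕ) (α : DiffForm E M) (hα : α ∈ locallyConserved n w X (k + 1)) :
        extD α ∈ strictlyConserved n w X k :=
      ⟨extD_mem_hamiltonianMultiForms hα.1.1, ((formCalculus E M).d_lieD X α).symm.trans hα.2⟩
    exact obsBracket_one_mem_regrade (S := locallyConserved n w X) (fun _ _ hα => hα.1.1) extD_mem
      (hx 0)
  · refine hw.obsBracket_add_two_mem_regrade
      (fun a => hamiltonianObservables_le _ (regrade_mono (fun _ => inf_le_left) _ (hx a)))
      fun hd => ⟨hw.obsBracket_mem_hamiltonianMultiForms x, ?_⟩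
    exact hw.lieDeriv_obsBracket_eq_zero hX fun a => regrade_zero_le _ (hd a ▸ hx a)

theorem isLInftySubalgebra_of_le_locallyConserved (hw : IsNPlectic n w) {X : VField E M}
    (hX : lieDeriv X w = 0) {S : ℕ → Submodule ℝ (DiffForm E M)}
    (hS : ∀ k, strictlyConserved n w X k ≤ S k) (hS' : ∀ k, S k ≤ locallyConserved n w X k) :
    IsLInftySubalgebra (regrade n S) (hamiltonianObservables n w) (obsBracket n w) where
  ambient := hw.isLInftyAlgebra_observables.restrict hamiltonianObservables_le
    hw.isLInftySubalgebra_hamiltonianObservables.closed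
  le := regrade_mono fun k => (hS' k).trans inf_le_left
  closed _ hk _ _ hx := regrade_mono hS _ <| hw.obsBracket_mem_strictlyConserved hX hk
    fun a => regrade_mono hS' _ (hx a)

end IsNPlectic

end LieNAlgebra

end Multisymplectic

end

open Multisymplectic in
theorem mainTheorem12_general
    {E : Type*} [NormedAddCommGroup E] [NormedSpace ℝ E] [FiniteDimensional ℝ E]
    {M : Type*} [TopologicalSpace M] [ChartedSpace E M] [IsManifold 𝓘(ℝ, E) ∞ M]
    (n : ℕ) (w : DiffForm E M) (hw : IsNPlectic n w) :
    IsLieNAlgebra n (observables n w) (obsBracket n w) ∧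
    IsLInftySubalgebra (hamiltonianObservables n w) (observables n w) (obsBracket n w) ∧
    ∀ X : VField E M, lieDeriv X w = 0 →
      IsLInftySubalgebra (regrade n (globallyConserved n w X))
        (hamiltonianObservables n w) (obsBracket n w) ∧
      IsLInftySubalgebra (regrade n (locallyConserved n w X))
        (hamiltonianObservables n w) (obsBracket n w) ∧
      IsLInftySubalgebra (regrade n (strictlyConserved n w X))
        (hamiltonianObservables n w) (obsBracket n w) := by
  refine ⟨hw.isLieNAlgebra_observables, hw.isLInftySubalgebra_hamiltonianObservables,
    fun X hX => ⟨?_, ?_, ?_⟩⟩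
  · exact hw.isLInftySubalgebra_of_le_locallyConserved hX (strictlyConserved_le X)
      (globallyConserved_le X)
  · exact hw.isLInftySubalgebra_of_le_locallyConserved hX
      (fun k => (strictlyConserved_le X k).trans (globallyConserved_le X k)) fun _ => le_rfl
  · exact hw.isLInftySubalgebra_of_le_locallyConserved hX (fun _ => le_rfl)
      fun k => (strictlyConserved_le X k).trans (globallyConserved_le X k)

theorem mainTheorem12
    {E : Type*} [NormedAddCommGroup E] [NormedSpace ℝ E] [FiniteDimensional ℝ E]
    {M : Type*} [TopologicalSpace M] [T2Space M] [SigmaCompactSpace M]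
    [ChartedSpace E M] [IsManifold 𝓘(ℝ, E) ∞ M]
    (n : ℕ) (hn : 1 ≤ n) (w : Multisymplectic.DiffForm E M) (hw : Multisymplectic.IsNPlectic n w) :
    Multisymplectic.IsLieNAlgebra n
      (Multisymplectic.observables n w) (Multisymplectic.obsBracket n w) ∧
    Multisymplectic.IsLInftySubalgebra
      (Multisymplectic.hamiltonianObservables n w)
      (Multisymplectic.observables n w) (Multisymplectic.obsBracket n w) ∧
    ∀ H ∈ Multisymplectic.hamiltonianForms n w, ∀ XH : Multisymplectic.VField E M,
      Multisymplectic.IsHamiltonianVField w H XH →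
      Multisymplectic.IsLInftySubalgebra
        (Multisymplectic.regrade n (Multisymplectic.globallyConserved n w XH))
        (Multisymplectic.hamiltonianObservables n w) (Multisymplectic.obsBracket n w) ∧
      Multisymplectic.IsLInftySubalgebra
        (Multisymplectic.regrade n (Multisymplectic.locallyConserved n w XH))
        (Multisymplectic.hamiltonianObservables n w) (Multisymplectic.obsBracket n w) ∧
      Multisymplectic.IsLInftySubalgebra
        (Multisymplectic.regrade n (Multisymplectic.strictlyConserved n w XH))
        (Multisymplectic.hamiltonianObservables n w) (Multisymplectic.obsBracket n w) := by
  obtain ⟨hL, hHam, hcons⟩ := mainTheorem12_general n w hw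
  exact ⟨hL, hHam, fun _ _ XH hXH => hcons XH (hw.lieDeriv_of_isHamiltonianVField hXH)⟩
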